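/- Let $G_1$ and $G_2$ be the groups generated by $f_1,\dots,f_6$ subject to the relations $f_if_j=T_{ij}$, where $T$ is the following table of products (row $i$, column $j$). In both cases $f_5,f_6$ are central involutions, $f_4f_1=f_1f_4$, $f_3f_2=f_2f_3$, $f_4f_3=f_3f_4$, $f_2f_1=f_1f_2f_5$, $f_3f_1=f_1f_3f_6$, $f_4f_2=f_2f_4f_5$, $f_2^2=f_6$ (the entries above the diagonal are the tautological ones $f_if_j$); the remaining entries are $$G_1:\ f_1^2=f_5,\ f_3^2=1,\ f_4^2=1;\qquad G_2:\ f_1^2=1,\ f_3^2=f_5,\ f_4^2=f_5.$$ Let $G_{\mathrm{IK}}=(C_4\times C_4)\rtimes H$ be the Izumi–Kosaki group, where $H=\{1,h_1,h_2,h_1h_2\}\subset SL_2(\mathbb Z/4)$ with $h_1=\begin{pmatrix}1&2\\0&1\end{pmatrix}$, $h_2=\begin{pmatrix}1&0\\2&1\end{pmatrix}$, acts on column vectors by matrix multiplication. For a finite group $G$, let $\mathrm{Rep}(G)$ be the $C^*$-tensor category of its finite dimensional unitary representations. Two finite groups $G,K$ are called monoidally equivalent if there are $\mathbb C$-linear,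 $*$-preserving tensor functors $\mathrm{Rep}(G)\to\mathrm{Rep}(K)$ and $\mathrm{Rep}(K)\to\mathrm{Rep}(G)$ with unitary structure maps whose two composites are isomorphic to the identity functors by unitary monoidal natural isomorphisms. The order list of $G$ is the list of the numbers of elements of order $d$, with $d$ running through the divisors of $|G|$ in increasing order. For a normal abelian subgroup $N\subset G$ with dual group $\widehat N$, and $\sigma\in\widehat N$, $g\in G$, put $\sigma^g(n)=\sigma(gng^{-1})$. A 2-cocycle $\omega:\widehat N\times\widehat N\to\mathbb T$ is non-degenerate if $\omega(\sigma,\tau)=\omega(\tau,\sigma)$ for all $\tau$ implies $\sigma=1$, and $G$-invariant if, for every $g$, the cocycle $(\sigma,\tau)\mapsto\omega(\sigma^g,\tau^g)$ differs from $\omega$ by a coboundary $\xi(\sigma)\xi(\tau)\overline{\xi(\sigma\tau)}$ with $\xi:\widehat N\to\mathbb T$. Regarding $\omega$ as a unitary of $C(\widehat N)\otimes C(\widehat N)\cong\mathbb C[N]\otimes\mathbb C[N]\subset\mathbb C[G]\otimes\mathbb C[G]$, put $\Delta^\omega(a)=\omega^*\Delta(a)\omega$ on $\mathbb C[G]$,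 where $\Delta(g)=g\otimes g$. A finite group $K$ is called the twist $G^\omega$ if there is a $*$-isomorphism $\mathbb C[K]\to\mathbb C[G]$ that intertwines $\Delta$ with $\Delta^\omega$. Then the following hold. 1. $|G_1|=|G_2|=64$, and the order list of both groups is $\{1,19,44,0,0,0,0\}$. 2. $G_1$ and $G_2$ are not isomorphic, but they are monoidally equivalent. 3. There is an isomorphism $e:G_1\to G_{\mathrm{IK}}$ with $e(f_1f_4)=(1,0)^t$ and $e(f_2)=(0,1)^t$. In particular it maps the subgroup $N=\langle f_1f_4,f_2\rangle$, which is normal in $G_1$, onto the factor $C_4\times C_4$. Let $\omega$ be the function on $\widehat N\times\widehat N$ given by $\omega(\sigma,\tau)=i^{ab}$ whenever $\sigma(f_1f_4)=i^a$ and $\tau(f_2)=i^b$. It is a non-degenerate, $G_1$-invariant 2-cocycle, and $G_2$ is the twist $G_1^\omega$. -/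

import Mathlib

open CategoryTheory MonoidalCategory
open scoped TensorProduct

noncomputable section

/-! ### Unitary representations as a `C*`-tensor category -/

/-- A finite dimensional unitary representation of `G`: a finite dimensional complex Hilbert space
with a homomorphism from `G` to its unitary group. -/
structure UnitaryRep (G : Type) [Group G] where
  V : Type
  [instNormed : NormedAddCommGroup V]
  [instInner : InnerProductSpace ℂ V]
  [instFinDim : FiniteDimensional ℂ V]
  ρ : G →* (V ≃ₗᵢ[ℂ] V)

namespace UnitaryRep

attribute [instance] UnitaryRep.instNormed UnitaryRep.instInner
  UnitaryRep.instFinDim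

variable {G : Type} [Group G]

/-- The space of intertwining operators. -/
def intertwiners (U W : UnitaryRep G) : Submodule ℂ (U.V →ₗ[ℂ] W.V) where
  carrier := {T | ∀ (g : G) (v : U.V), T (U.ρ g v) = W.ρ g (T v)}
  add_mem' := fun {S T} hS hT g v => by simp [hS g v, hT g v]
  zero_mem' := fun g v => by simp
  smul_mem' := fun c T hT g v => by simp [hT g v]

instance : Category (UnitaryRep G) where
  Hom U W := intertwiners U W
  id U := ⟨LinearMap.id, fun _ _ => rfl⟩
  comp S T := ⟨T.1 ∘ₗ S.1, fun g v => by
    have h1 := S.2 g v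
    have h2 := T.2 g (S.1 v)
    simp only [LinearMap.comp_apply, h1, h2]⟩

/-- The linear map underlying a morphism. -/
def lin {U W : UnitaryRep G} (T : U ⟶ W) : U.V →ₗ[ℂ] W.V := Subtype.val T

/-- The morphism given by an equivariant linear map. -/
def homMk {U W : UnitaryRep G} (T : U.V →ₗ[ℂ] W.V)
    (h : ∀ (g : G) (v : U.V), T (U.ρ g v) = W.ρ g (T v)) : U ⟶ W := Subtype.mk T h

lemma lin_comm {U W : UnitaryRep G} (T : U ⟶ W) (g : G) (v : U.V) :
    lin T (U.ρ g v) = W.ρ g (lin T v) := T.2 g v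

@[ext] lemma hom_ext {U W : UnitaryRep G} {S T : U ⟶ W} (h : lin S = lin T) : S = T :=
  Subtype.ext h

@[simp] lemma lin_homMk {U W : UnitaryRep G} (T : U.V →ₗ[ℂ] W.V)
    (h : ∀ (g : G) (v : U.V), T (U.ρ g v) = W.ρ g (T v)) : lin (homMk T h) = T := rfl

@[simp] lemma lin_id (U : UnitaryRep G) : lin (𝟙 U) = LinearMap.id := rfl

@[simp] lemma lin_comp {U W X : UnitaryRep G} (S : U ⟶ W) (T : W ⟶ X) :
    lin (S ≫ T) = lin T ∘ₗ lin S := rfl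

instance : Preadditive (UnitaryRep G) where
  homGroup U W := inferInstanceAs (AddCommGroup (intertwiners U W))
  add_comp _ _ _ S S' T := Subtype.ext (LinearMap.comp_add (lin S) (lin S') (lin T))
  comp_add _ _ _ _ _ _ := rfl

instance : Linear ℂ (UnitaryRep G) where
  homModule U W := inferInstanceAs (Module ℂ (intertwiners U W))
  smul_comp _ _ _ r S T := Subtype.ext (LinearMap.ext fun v => (lin T).map_smul r (lin S v))
  comp_smul _ _ _ _ _ _ := rfl

lemma equivariant_of_eq {U W : UnitaryRep G} (T : U.V →ₗ[ℂ] W.V)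
    (h : ∀ g : G, T ∘ₗ (U.ρ g).toLinearEquiv.toLinearMap =
      (W.ρ g).toLinearEquiv.toLinearMap ∘ₗ T) (g : G) (v : U.V) :
    T (U.ρ g v) = W.ρ g (T v) := LinearMap.congr_fun (h g) v

/-- The isomorphism given by an equivariant linear equivalence. -/
def isoMk {U W : UnitaryRep G} (e : U.V ≃ₗ[ℂ] W.V)
    (h : ∀ g : G, e.toLinearMap ∘ₗ (U.ρ g).toLinearEquiv.toLinearMap =
      (W.ρ g).toLinearEquiv.toLinearMap ∘ₗ e.toLinearMap) : U ≅ W where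
  hom := homMk e.toLinearMap (equivariant_of_eq _ h)
  inv := homMk e.symm.toLinearMap fun g w => by
    apply e.injective
    have := equivariant_of_eq _ h g (e.symm w)
    simp only [LinearEquiv.coe_coe, LinearEquiv.apply_symm_apply] at this ⊢
    exact this.symm
  hom_inv_id := by ext v; simp
  inv_hom_id := by ext v; simp

/-- The tensor product representation `g ↦ ρ_U(g) ⊗ ρ_W(g)` on the Hilbert space tensor product. -/
abbrev tensor (U W : UnitaryRep G) : UnitaryRep G where
  V := U.V ⊗[ℂ] W.V
  ρ :=
    { toFun := fun g => TensorProduct.congrIsometry (U.ρ g) (W.ρ g)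
      map_one' := by
        apply LinearIsometryEquiv.toLinearEquiv_injective
        apply LinearEquiv.toLinearMap_injective
        ext; simp
      map_mul' := fun g h => by
        apply LinearIsometryEquiv.toLinearEquiv_injective
        apply LinearEquiv.toLinearMap_injective
        ext; simp }

/-- The trivial representation on `ℂ`. -/
abbrev triv (G : Type) [Group G] : UnitaryRep G where
  V := ℂ
  ρ := 1

/-- The tensor product of two intertwiners. -/
def tensorMap {U U' W W' : UnitaryRep G} (S : U ⟶ U') (T : W ⟶ W') :
    tensor U W ⟶ tensor U' W' :=
  homMk (TensorProduct.map (lin S) (lin T)) <|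
    equivariant_of_eq (U := tensor U W) (W := tensor U' W') _ fun g =>
      TensorProduct.ext' fun u w =>
        congrArg₂ (fun a b => a ⊗ₜ[ℂ] b) (lin_comm S g u) (lin_comm T g w)

/-- The associativity constraint `(u ⊗ w) ⊗ x ↦ u ⊗ (w ⊗ x)`. -/
def assocIso (U W X : UnitaryRep G) : tensor (tensor U W) X ≅ tensor U (tensor W X) :=
  isoMk (TensorProduct.assoc ℂ U.V W.V X.V) fun _ =>
    TensorProduct.ext_threefold fun _ _ _ => rfl

/-- The left unit constraint `c ⊗ u ↦ c u`. -/
def leftUnitIso (U : UnitaryRep G) : tensor (triv G) U ≅ U :=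
  isoMk (TensorProduct.lid ℂ U.V) fun g =>
    TensorProduct.ext' fun c u => ((U.ρ g).map_smul c u).symm

/-- The right unit constraint `u ⊗ c ↦ c u`. -/
def rightUnitIso (U : UnitaryRep G) : tensor U (triv G) ≅ U :=
  isoMk (TensorProduct.rid ℂ U.V) fun g =>
    TensorProduct.ext' fun u c => ((U.ρ g).map_smul c u).symm

instance : MonoidalCategory (UnitaryRep G) where
  tensorObj := tensor
  whiskerLeft U _ _ T := tensorMap (𝟙 U) T
  whiskerRight T U := tensorMap T (𝟙 U)
  tensorHom := tensorMap
  tensorUnit := triv G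
  associator := assocIso
  leftUnitor := leftUnitIso
  rightUnitor := rightUnitIso
  tensorHom_def _ _ := hom_ext <| TensorProduct.ext' fun _ _ => rfl
  id_tensorHom_id _ _ := hom_ext <| TensorProduct.ext' fun _ _ => rfl
  tensorHom_comp_tensorHom _ _ _ _ := hom_ext <| TensorProduct.ext' fun _ _ => rfl
  whiskerLeft_id _ _ := hom_ext <| TensorProduct.ext' fun _ _ => rfl
  id_whiskerRight _ _ := hom_ext <| TensorProduct.ext' fun _ _ => rfl
  associator_naturality _ _ _ := hom_ext <| TensorProduct.ext_threefold fun _ _ _ => rfl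
  leftUnitor_naturality T := hom_ext <| TensorProduct.ext' fun c u =>
    ((lin T).map_smul c u).symm
  rightUnitor_naturality T := hom_ext <| TensorProduct.ext' fun u c =>
    ((lin T).map_smul c u).symm
  pentagon _ _ _ _ := hom_ext <| TensorProduct.ext_fourfold fun _ _ _ _ => rfl
  triangle _ _ := hom_ext <| TensorProduct.ext_threefold fun u c w =>
    (TensorProduct.smul_tmul c u w).symm

/-- The involution `T ↦ T*` on morphisms (the Hilbert space adjoint). -/
def dag {U W : UnitaryRep G} (T : U ⟶ W) : W ⟶ U :=
  homMk (LinearMap.adjoint (lin T)) fun g w => by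
    refine ext_inner_left ℂ fun u => ?_
    have h1 : lin T u = W.ρ g (lin T ((U.ρ g).symm u)) := by
      rw [← lin_comm, LinearIsometryEquiv.apply_symm_apply]
    have h2 : inner ℂ u (U.ρ g (LinearMap.adjoint (lin T) w)) =
        inner ℂ ((U.ρ g).symm u) (LinearMap.adjoint (lin T) w) := by
      conv_lhs => rw [← (U.ρ g).apply_symm_apply u, LinearIsometryEquiv.inner_map_map]
    rw [h2, LinearMap.adjoint_inner_right, LinearMap.adjoint_inner_right, h1,
      LinearIsometryEquiv.inner_map_map]

/-- A morphism `T` is unitary if `T* T = 1` and `T T* = 1`. -/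
def IsUnitaryHom {U W : UnitaryRep G} (T : U ⟶ W) : Prop :=
  T ≫ dag T = 𝟙 U ∧ dag T ≫ T = 𝟙 W

end UnitaryRep

open UnitaryRep

/-- A tensor functor `F` between the `C*`-tensor categories of unitary representations is a unitary
tensor functor if it is linear on morphisms, preserves the involution, and its structure maps
`ℂ → F(ℂ)` and `F(U) ⊗ F(W) → F(U ⊗ W)` are unitary. -/
structure IsUnitaryTensorFunctor {G H : Type} [Group G] [Group H]
    (F : UnitaryRep G ⥤ UnitaryRep H) [F.Monoidal] : Prop where
  map_add : ∀ {U W : UnitaryRep G} (S T : U ⟶ W), F.map (S + T) = F.map S + F.map T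
  map_smul : ∀ {U W : UnitaryRep G} (c : ℂ) (T : U ⟶ W), F.map (c • T) = c • F.map T
  map_dag : ∀ {U W : UnitaryRep G} (T : U ⟶ W), F.map (dag T) = dag (F.map T)
  unit_unitary : IsUnitaryHom (Functor.LaxMonoidal.ε F)
  tensor_unitary : ∀ U W : UnitaryRep G, IsUnitaryHom (Functor.LaxMonoidal.μ F U W)

/-- `G` and `H` are monoidally equivalent (isocategorical): there are unitary tensor functors
`F : Rep G ⥤ Rep H` and `F' : Rep H ⥤ Rep G` such that both composites are naturally isomorphic to
the identity functors through unitary monoidal natural isomorphisms. -/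
def MonoidallyEquivalent (G H : Type) [Group G] [Group H] : Prop :=
  ∃ (F : UnitaryRep G ⥤ UnitaryRep H) (F' : UnitaryRep H ⥤ UnitaryRep G)
    (_ : F.Monoidal) (_ : F'.Monoidal)
    (α : 𝟭 (UnitaryRep G) ≅ F ⋙ F') (β : F' ⋙ F ≅ 𝟭 (UnitaryRep H)),
    IsUnitaryTensorFunctor F ∧ IsUnitaryTensorFunctor F' ∧
    NatTrans.IsMonoidal α.hom ∧ NatTrans.IsMonoidal β.hom ∧
    (∀ U, IsUnitaryHom (α.hom.app U)) ∧ (∀ W, IsUnitaryHom (β.hom.app W))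

/-! ### Order lists -/

/-- The list of the numbers of elements of order `d`, where `d` runs through the divisors of `|G|`
in increasing order. -/
def orderList (G : Type) [Group G] : List ℕ :=
  ((Nat.card G).divisors.sort (· ≤ ·)).map fun d => Nat.card {g : G // orderOf g = d}

/-! ### Cocycles on the dual of a normal abelian subgroup and twisted group algebras -/

section Twist

variable {G : Type} [Group G]

/-- The dual group `N̂` of a (finite abelian) group `N`. -/
abbrev CharGroup (N : Type) [Group N] : Type := N →* Circle

/-- `ω` is a `𝕋`-valued 2-cocycle on `N̂`. -/
def IsTwoCocycle {N : Type} [Group N] (ω : CharGroup N → CharGroup N → Circle) : Prop :=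
  ∀ ρ σ τ : CharGroup N, ω ρ σ * ω (ρ * σ) τ = ω σ τ * ω ρ (σ * τ)

/-- `ω` is non-degenerate: `ω(σ,τ) = ω(τ,σ)` for all `τ` only if `σ = 1`. -/
def IsNondegenerate {N : Type} [Group N] (ω : CharGroup N → CharGroup N → Circle) : Prop :=
  ∀ σ : CharGroup N, (∀ τ : CharGroup N, ω σ τ * (ω τ σ)⁻¹ = 1) → σ = 1

/-- The character `σ^g(n) = σ(g n g⁻¹)`. -/
def conjDual (N : Subgroup G) [N.Normal] (g : G) (σ : CharGroup N) : CharGroup N :=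
  σ.comp (MulAut.conjNormal g : MulAut N).toMonoidHom

/-- `ω` is `G`-invariant: for every `g` the cocycle `ω^g(σ,τ) = ω(σ^g,τ^g)` is equivalent to
`ω`. -/
def IsInvariantCocycle (N : Subgroup G) [N.Normal] (ω : CharGroup N → CharGroup N → Circle) : Prop :=
  ∀ g : G, ∃ ξ : CharGroup N → Circle, ∀ σ τ : CharGroup N,
    ω (conjDual N g σ) (conjDual N g τ) * (ω σ τ)⁻¹ = ξ σ * ξ τ * (ξ (σ * τ))⁻¹

/-- The involution `(∑ c_g g)* = ∑ conj(c_g) g⁻¹` of the group algebra. -/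
def groupStar (a : MonoidAlgebra ℂ G) : MonoidAlgebra ℂ G :=
  a.coeff.sum fun g c => MonoidAlgebra.single g⁻¹ (star c)

/-- The projection `|N|⁻¹ ∑ₙ conj(σ(n)) n` of the group algebra, which corresponds to the indicator
function of `σ` under the isomorphism `ℂ[N] ≅ C(N̂)`, `n ↦ (τ ↦ τ(n))`. -/
def dualProj (N : Subgroup G) (σ : CharGroup N) : MonoidAlgebra ℂ G :=
  ∑ᶠ n : N, MonoidAlgebra.single (n : G) ((Nat.card N : ℂ)⁻¹ * star (σ n : ℂ))

/-- A function `ω` on `N̂ × N̂` as an element of `ℂ[N] ⊗ ℂ[N] ⊆ ℂ[G] ⊗ ℂ[G]`, by Fourier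
transform. -/
def cocycleElement (N : Subgroup G) (ω : CharGroup N → CharGroup N → Circle) :
    MonoidAlgebra ℂ G ⊗[ℂ] MonoidAlgebra ℂ G :=
  ∑ᶠ p : CharGroup N × CharGroup N, (ω p.1 p.2 : ℂ) • (dualProj N p.1 ⊗ₜ[ℂ] dualProj N p.2)

/-- The twisted coproduct `Δ^ω(a) = ω* Δ(a) ω` on `ℂ[G]`. As the `dualProj N σ` are
self-adjoint, the adjoint of the element given by `ω` is the one given by the complex conjugate
`ω⁻¹`. -/
def twistedComul (N : Subgroup G) (ω : CharGroup N → CharGroup N → Circle) (a : MonoidAlgebra ℂ G) :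
    MonoidAlgebra ℂ G ⊗[ℂ] MonoidAlgebra ℂ G :=
  cocycleElement N (fun σ τ => (ω σ τ)⁻¹) * Coalgebra.comul (R := ℂ) a * cocycleElement N ω

/-- The group `K` is the twist `G^ω` of `G`: the finite quantum group `(ℂ[G], Δ^ω)`, whose dual is
`G^ω`, is isomorphic to the group algebra `(ℂ[K], Δ)`, whose dual is `K`, by a `*`-isomorphism that
intertwines the coproducts. -/
def IsTwistBy (N : Subgroup G) (ω : CharGroup N → CharGroup N → Circle) (K : Type) [Group K] : Prop :=
  ∃ Φ : MonoidAlgebra ℂ K ≃ₐ[ℂ] MonoidAlgebra ℂ G,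
    (∀ a, Φ (groupStar a) = groupStar (Φ a)) ∧
    ∀ a, twistedComul N ω (Φ a) =
      TensorProduct.map Φ.toLinearMap Φ.toLinearMap (Coalgebra.comul (R := ℂ) a)

end Twist

/-! ### The groups -/

/-- The group with generators `f₁, …, f₆` (here numbered from `0`) and the relations
`fᵢ fⱼ = T i j` given by a multiplication table `T`. -/
abbrev TableGroup (T : Fin 6 → Fin 6 → FreeGroup (Fin 6)) : Type :=
  PresentedGroup {r | ∃ i j, r = FreeGroup.of i * FreeGroup.of j * (T i j)⁻¹}

/-- The free generators `f₁, …, f₆` as `gen 1, …, gen 6`. -/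
abbrev gen (k : ℕ) : FreeGroup (Fin 6) := FreeGroup.of (Fin.ofNat 6 (k - 1))

/-- The multiplication table of the generators of `G₁`. -/
def table₁ : Fin 6 → Fin 6 → FreeGroup (Fin 6) :=
  ![![gen 5, gen 1 * gen 2, gen 1 * gen 3, gen 1 * gen 4, gen 1 * gen 5, gen 1 * gen 6],
    ![gen 1 * gen 2 * gen 5, gen 6, gen 2 * gen 3, gen 2 * gen 4, gen 2 * gen 5, gen 2 * gen 6],
    ![gen 1 * gen 3 * gen 6, gen 2 * gen 3, 1, gen 3 * gen 4, gen 3 * gen 5, gen 3 * gen 6],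
    ![gen 1 * gen 4, gen 2 * gen 4 * gen 5, gen 3 * gen 4, 1, gen 4 * gen 5, gen 4 * gen 6],
    ![gen 1 * gen 5, gen 2 * gen 5, gen 3 * gen 5, gen 4 * gen 5, 1, gen 5 * gen 6],
    ![gen 1 * gen 6, gen 2 * gen 6, gen 3 * gen 6, gen 4 * gen 6, gen 5 * gen 6, 1]]

/-- The multiplication table of the generators of `G₂`. -/
def table₂ : Fin 6 → Fin 6 → FreeGroup (Fin 6) :=
  ![![1, gen 1 * gen 2, gen 1 * gen 3, gen 1 * gen 4, gen 1 * gen 5, gen 1 * gen 6],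
    ![gen 1 * gen 2 * gen 5, gen 6, gen 2 * gen 3, gen 2 * gen 4, gen 2 * gen 5, gen 2 * gen 6],
    ![gen 1 * gen 3 * gen 6, gen 2 * gen 3, gen 5, gen 3 * gen 4, gen 3 * gen 5, gen 3 * gen 6],
    ![gen 1 * gen 4, gen 2 * gen 4 * gen 5, gen 3 * gen 4, gen 5, gen 4 * gen 5, gen 4 * gen 6],
    ![gen 1 * gen 5, gen 2 * gen 5, gen 3 * gen 5, gen 4 * gen 5, 1, gen 5 * gen 6],
    ![gen 1 * gen 6, gen 2 * gen 6, gen 3 * gen 6, gen 4 * gen 6, gen 5 * gen 6, 1]]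

/-- The group `G₁`. -/
abbrev GroupOne : Type := TableGroup table₁

/-- The group `G₂`. -/
abbrev GroupTwo : Type := TableGroup table₂

/-- The generator `f_k` of `G₁`. -/
def genOne (k : ℕ) : GroupOne := PresentedGroup.mk _ (gen k)

/-- The subgroup of `G₁` generated by `f₁f₄` and `f₂`. -/
def subgroupN : Subgroup GroupOne := Subgroup.closure {genOne 1 * genOne 4, genOne 2}

/-- `f₁f₄` as an element of the subgroup. -/
def xN : subgroupN := ⟨genOne 1 * genOne 4, Subgroup.subset_closure (by simp)⟩

/-- `f₂` as an element of the subgroup. -/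
def yN : subgroupN := ⟨genOne 2, Subgroup.subset_closure (by simp)⟩

/-- The matrix `h₁`. -/
def hOne : Matrix.SpecialLinearGroup (Fin 2) (ZMod 4) := ⟨!![1, 2; 0, 1], by decide⟩

/-- The matrix `h₂`. -/
def hTwo : Matrix.SpecialLinearGroup (Fin 2) (ZMod 4) := ⟨!![1, 0; 2, 1], by decide⟩

/-- The subgroup `H = {1, h₁, h₂, h₁h₂}` of `SL₂(ℤ/4)`. -/
def groupH : Subgroup (Matrix.SpecialLinearGroup (Fin 2) (ZMod 4)) where
  carrier := {1, hOne, hTwo, hOne * hTwo}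
  one_mem' := by simp
  mul_mem' := by
    rintro a b (rfl | rfl | rfl | rfl) (rfl | rfl | rfl | rfl) <;>
      simp only [Set.mem_insert_iff, Set.mem_singleton_iff] <;> decide
  inv_mem' := by
    rintro a (rfl | rfl | rfl | rfl) <;>
      simp only [Set.mem_insert_iff, Set.mem_singleton_iff] <;> decide

/-- The action of `H` on the column vectors `(ℤ/4)²` by matrix multiplication. -/
def actionH : groupH →* MulAut (Multiplicative (Fin 2 → ZMod 4)) where
  toFun h := AddEquiv.toMultiplicative
    (Matrix.SpecialLinearGroup.toLin' (h : Matrix.SpecialLinearGroup (Fin 2) (ZMod 4))).toAddEquiv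
  map_one' := by ext v; simp
  map_mul' a b := by ext v; simp

lemma actionH_apply (h : groupH) (v : Fin 2 → ZMod 4) :
    actionH h (Multiplicative.ofAdd v) =
      Multiplicative.ofAdd ((h : Matrix (Fin 2) (Fin 2) (ZMod 4)).mulVec v) := rfl

/-- The Izumi–Kosaki group `(C₄ × C₄) ⋊ H`. -/
abbrev IzumiKosakiGroup : Type := Multiplicative (Fin 2 → ZMod 4) ⋊[actionH] groupH

/-- The copy of `C₄ × C₄` in the Izumi–Kosaki group, written as column vectors. -/
def columnVec (a b : ZMod 4) : IzumiKosakiGroup := SemidirectProduct.inl (Multiplicative.ofAdd ![a, b])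

end

/-! Both groups are central extensions of (ℤ/2)⁴ by ⟨f₅, f₆⟩, so they have concrete models: exponent
vectors, added with a bilinear correction in the last two coordinates (`PcModel`, `equivOne`,
`equivTwo`). Orders, centralizers and conjugation formulas become finite checks there. The groups
differ because in G₁ the involution f₃ is noncentral with centralizer of index two, while G₂ has no
such involution.

The twist rests on a quadratic refinement. Write x = f₁f₄, y = f₂ and give a character of N the
coordinates σ(x) = i^a, σ(y) = i^b. Conjugation acts on N through the matrices of H and changes ω(σ,
τ) = i^(ad), where τ has coordinates (c, d), by a factor i^(2(s·bd + t·ac)) (`cocycle_conjDual`). As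
2ac is the polarization of a², this factor is the coboundary of an inverse power of i^(a²) and
i^(b²); hence ω is invariant.

As elements of ℂ[N], the functions i^(a²) and i^(b²) are the unitaries U = (1 + f₅)/2 + i(1 - f₅)/2
and V = (1 + f₆)/2 + i(1 - f₆)/2, which are central in ℂ[G₁] and satisfy U² = f₅, V² = f₆.
Multiplying a group element by the matching unitary makes it group-like for Δ^ω
(`singleUnit_mul_mem`). Thus f₁U, f₂, f₃f₁f₄V, f₄U, f₅, f₆ are group-like, and U² and V² alter the
squares so that exactly the relations of G₂ hold (`Relations.twist`). The resulting map ℂ[G₂] →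
ℂ[G₁] is onto, because its image contains f₅ and f₆, hence U and V; it is bijective since both
dimensions are 64.

Such an isomorphism gives a monoidal equivalence (`IsTwistIso.monoidallyEquivalent`):
representations are transported without changing their Hilbert spaces, and the action of ω on a
tensor product is the tensor structure. Its equivariance is the intertwining of Δ with Δ^ω, its
associativity is the cocycle identity, and it is unitary because ω takes values in the circle. -/

/-! ### Polycyclic models of the two groups -/

/-- The set of exponent vectors `(a₁, …, a₆)` of normal words `f₁^a₁ ⋯ f₆^a₆`. -/
structure PcModel (s : ZMod 2) where
  a : ZMod 2
  b : ZMod 2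
  c : ZMod 2
  d : ZMod 2
  e : ZMod 2
  f : ZMod 2

namespace PcModel

variable {s : ZMod 2}

/-- Exponent vectors as tuples. -/
def equivProd : PcModel s ≃ ZMod 2 × ZMod 2 × ZMod 2 × ZMod 2 × ZMod 2 × ZMod 2 where
  toFun x := (x.a, x.b, x.c, x.d, x.e, x.f)
  invFun x := ⟨x.1, x.2.1, x.2.2.1, x.2.2.2.1, x.2.2.2.2.1, x.2.2.2.2.2⟩
  left_inv _ := rfl
  right_inv _ := rfl

instance : DecidableEq (PcModel s) := equivProd.decidableEq

instance : Fintype (PcModel s) := Fintype.ofEquiv _ equivProd.symm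

/-- Multiplication of normal words: `s = 0` gives `G₁` and `s = 1` gives `G₂`. -/
instance : Mul (PcModel s) where
  mul x y := ⟨x.a + y.a, x.b + y.b, x.c + y.c, x.d + y.d,
    x.e + y.e + x.b * y.a + x.d * y.b + (1 - s) * (x.a * y.a) + s * (x.c * y.c + x.d * y.d),
    x.f + y.f + x.c * y.a + x.b * y.b⟩

instance : One (PcModel s) := ⟨⟨0, 0, 0, 0, 0, 0⟩⟩

instance : Inv (PcModel s) where
  inv x := ⟨-x.a, -x.b, -x.c, -x.d,
    -x.e + x.b * x.a + x.d * x.b + (1 - s) * (x.a * x.a) + s * (x.c * x.c + x.d * x.d),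
    -x.f + x.c * x.a + x.b * x.b⟩

lemma mul_def (x y : PcModel s) : x * y = ⟨x.a + y.a, x.b + y.b, x.c + y.c, x.d + y.d,
    x.e + y.e + x.b * y.a + x.d * y.b + (1 - s) * (x.a * y.a) + s * (x.c * y.c + x.d * y.d),
    x.f + y.f + x.c * y.a + x.b * y.b⟩ := rfl

lemma one_def : (1 : PcModel s) = ⟨0, 0, 0, 0, 0, 0⟩ := rfl

lemma inv_def (x : PcModel s) : x⁻¹ = ⟨-x.a, -x.b, -x.c, -x.d,
    -x.e + x.b * x.a + x.d * x.b + (1 - s) * (x.a * x.a) + s * (x.c * x.c + x.d * x.d),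
    -x.f + x.c * x.a + x.b * x.b⟩ := rfl

/-- The corrections in the last two coordinates are bilinear forms in the first four. A bilinear
form is a 2-cocycle, which gives associativity; its values on the diagonal correct the inverse. -/
instance : Group (PcModel s) :=
  Group.ofLeftAxioms
    (fun x y z => by simp only [mul_def]; congr 1 <;> ring)
    (fun x => by simp [mul_def, one_def])
    (fun x => by simp only [mul_def, one_def, inv_def]; congr 1 <;> ring)

lemma card_eq : Nat.card (PcModel s) = 64 := by
  rw [Nat.card_congr equivProd]; simp

/-- The generators of the model. -/
def gens : Fin 6 → PcModel s :=
  ![⟨1, 0, 0, 0, 0, 0⟩, ⟨0, 1, 0, 0, 0, 0⟩, ⟨0, 0, 1, 0, 0, 0⟩, ⟨0, 0, 0, 1, 0, 0⟩,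
    ⟨0, 0, 0, 0, 1, 0⟩, ⟨0, 0, 0, 0, 0, 1⟩]

lemma exists_zmod_two {p : ZMod 2 → Prop} (h0 : p 0) (h1 : p 1) (x : ZMod 2) : p x := by
  fin_cases x
  exacts [h0, h1]

/-- The defining relations of `G₁` (for `s = 0`) and `G₂` (for `s = 1`). -/
structure Relations (s : ZMod 2) {P : Type*} [Group P] (g : Fin 6 → P) : Prop where
  sq_zero : g 0 * g 0 = g 4 ^ (1 - s).val
  sq_one : g 1 * g 1 = g 5
  sq_two : g 2 * g 2 = g 4 ^ s.val
  sq_three : g 3 * g 3 = g 4 ^ s.val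
  sq_four : g 4 * g 4 = 1
  sq_five : g 5 * g 5 = 1
  one_zero : g 1 * g 0 = g 0 * g 1 * g 4
  two_zero : g 2 * g 0 = g 0 * g 2 * g 5
  two_one : g 2 * g 1 = g 1 * g 2
  three_zero : g 3 * g 0 = g 0 * g 3
  three_one : g 3 * g 1 = g 1 * g 3 * g 4
  three_two : g 3 * g 2 = g 2 * g 3
  four_zero : g 4 * g 0 = g 0 * g 4
  four_one : g 4 * g 1 = g 1 * g 4
  four_two : g 4 * g 2 = g 2 * g 4
  four_three : g 4 * g 3 = g 3 * g 4
  five_zero : g 5 * g 0 = g 0 * g 5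
  five_one : g 5 * g 1 = g 1 * g 5
  five_two : g 5 * g 2 = g 2 * g 5
  five_three : g 5 * g 3 = g 3 * g 5
  five_four : g 5 * g 4 = g 4 * g 5

/-! ### Collecting words into normal form -/

section NormalForm

variable {P : Type*} [Group P] {g : Fin 6 → P}

/-- A power with exponent in `ℤ/2`. -/
def bitPow (u : P) (x : ZMod 2) : P := u ^ x.val

@[simp] lemma bitPow_zero (u : P) : bitPow u 0 = 1 := pow_zero u

@[simp] lemma bitPow_one (u : P) : bitPow u 1 = u := pow_one u

/-- Addition in ℤ/2 drops the carry, which is `x * y`; each carry replaces a square of `u` by a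
power of `v`. -/
lemma bitPow_mul_self {u v : P} {t : ZMod 2} (h : u * u = bitPow v t) (x y : ZMod 2) :
    bitPow u x * bitPow u y = bitPow u (x + y) * bitPow v (t * (x * y)) := by
  have two : (1 : ZMod 2) + 1 = 0 := by decide
  induction x using exists_zmod_two <;> induction y using exists_zmod_two <;> simp [two, h]

lemma bitPow_mul_comm {u v : P} (h : u * v = v * u) (x y : ZMod 2) :
    bitPow u x * bitPow v y = bitPow v y * bitPow u x :=
  ((show Commute u v from h).pow_pow _ _).eq

/-- A commutator appears only when both bits are one, so nothing needs to be known about how `w`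
commutes with the rest. -/
lemma bitPow_mul_swap {u v w : P} (h : u * v = v * u * w) (x y : ZMod 2) :
    bitPow u x * bitPow v y = bitPow v y * (bitPow u x * bitPow w (x * y)) := by
  induction x using exists_zmod_two <;> induction y using exists_zmod_two <;> simp [h, mul_assoc]

/-- Lets a rule for two adjacent factors apply inside a right-associated product. -/
lemma mul_eq_assoc {M : Type*} [Semigroup M] {x y z : M} (h : x * y = z) (t : M) :
    x * (y * t) = z * t := by
  rw [← mul_assoc, h]

/-- The normal word with given exponents. -/
def word (g : Fin 6 → P) (x : PcModel s) : P :=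
  bitPow (g 0) x.a * (bitPow (g 1) x.b * (bitPow (g 2) x.c * (bitPow (g 3) x.d *
    (bitPow (g 4) x.e * bitPow (g 5) x.f))))

lemma word_one : word g (1 : PcModel s) = 1 := by simp [word, one_def]

/-- This is the collection process: the rules move generators of smaller index to the left and merge
equal ones. The two central exponents accumulate exactly the bilinear corrections in the
multiplication of the model. -/
lemma word_mul (h : Relations s g) (x y : PcModel s) : word g (x * y) = word g x * word g y := by
  have s0 := bitPow_mul_self h.sq_zero
  have s1 := bitPow_mul_self (h.sq_one.trans (bitPow_one _).symm)
  have s2 := bitPow_mul_self h.sq_two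
  have s3 := bitPow_mul_self h.sq_three
  -- A vanishing square is the case `t = 0`; the base 1 is a dummy.
  have s4 := bitPow_mul_self (h.sq_four.trans (bitPow_zero 1).symm)
  have s5 := bitPow_mul_self (h.sq_five.trans (bitPow_zero 1).symm)
  simp only [zero_mul, one_mul, mul_one, bitPow_zero] at s1 s4 s5
  have a0 := fun x y => mul_eq_assoc (s0 x y)
  have a1 := fun x y => mul_eq_assoc (s1 x y)
  have a2 := fun x y => mul_eq_assoc (s2 x y)
  have a3 := fun x y => mul_eq_assoc (s3 x y)
  have a4 := fun x y => mul_eq_assoc (s4 x y)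
  have b10 := fun x y => mul_eq_assoc (bitPow_mul_swap h.one_zero x y)
  have b20 := fun x y => mul_eq_assoc (bitPow_mul_swap h.two_zero x y)
  have b21 := fun x y => mul_eq_assoc (bitPow_mul_comm h.two_one x y)
  have b30 := fun x y => mul_eq_assoc (bitPow_mul_comm h.three_zero x y)
  have b31 := fun x y => mul_eq_assoc (bitPow_mul_swap h.three_one x y)
  have b32 := fun x y => mul_eq_assoc (bitPow_mul_comm h.three_two x y)
  have b40 := fun x y => mul_eq_assoc (bitPow_mul_comm h.four_zero x y)
  have b41 := fun x y => mul_eq_assoc (bitPow_mul_comm h.four_one x y)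
  have b42 := fun x y => mul_eq_assoc (bitPow_mul_comm h.four_two x y)
  have b43 := fun x y => mul_eq_assoc (bitPow_mul_comm h.four_three x y)
  have b50 := fun x y => mul_eq_assoc (bitPow_mul_comm h.five_zero x y)
  have b51 := fun x y => mul_eq_assoc (bitPow_mul_comm h.five_one x y)
  have b52 := fun x y => mul_eq_assoc (bitPow_mul_comm h.five_two x y)
  have b53 := fun x y => mul_eq_assoc (bitPow_mul_comm h.five_three x y)
  have b54 := fun x y => mul_eq_assoc (bitPow_mul_comm h.five_four x y)
  simp only [word, mul_assoc, s5, a0, a1, a2, a3, a4, b10, b20, b21, b30, b31, b32, b40, b41,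
    b42, b43, b50, b51, b52, b53, b54]
  simp only [mul_def]
  -- Only the exponents of the two central generators still have to be compared.
  congr 5
  · congr 1
    ring
  · congr 1
    ring

/-- The homomorphism from the model to a group in which the relations hold. -/
def wordHom (h : Relations s g) : PcModel s →* P where
  toFun := word g
  map_one' := word_one
  map_mul' := word_mul h

lemma word_gens (i : Fin 6) : word g (gens i : PcModel s) = g i := by
  fin_cases i <;> simp [word, gens]

end NormalForm

lemma relations_gens : Relations s (gens (s := s)) := by
  induction s using exists_zmod_two <;> constructor <;> decide

/-- Every exponent vector is its own normal word in the generators. -/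
lemma closure_gens : Subgroup.closure (Set.range (gens (s := s))) = ⊤ := by
  refine (Subgroup.eq_top_iff' _).2 fun x => ?_
  have hx : x = word gens x := by
    revert x
    induction s using exists_zmod_two <;> decide
  have h (i : Fin 6) (t : ZMod 2) :
      bitPow (gens i : PcModel s) t ∈ Subgroup.closure (Set.range (gens (s := s))) :=
    Subgroup.pow_mem _ (Subgroup.subset_closure (Set.mem_range_self i)) _
  rw [hx]
  exact mul_mem (h _ _) (mul_mem (h _ _) (mul_mem (h _ _) (mul_mem (h _ _)
    (mul_mem (h _ _) (h _ _)))))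

end PcModel

/-! ### The groups given by the multiplication tables -/

namespace TableGroup

variable {T : Fin 6 → Fin 6 → FreeGroup (Fin 6)}

lemma mk_mul_mk (T : Fin 6 → Fin 6 → FreeGroup (Fin 6)) (i j : Fin 6) :
    (PresentedGroup.of i * PresentedGroup.of j : TableGroup T) = PresentedGroup.mk _ (T i j) := by
  have h := PresentedGroup.one_of_mem
    (rels := {r | ∃ i j, r = FreeGroup.of i * FreeGroup.of j * (T i j)⁻¹}) ⟨i, j, rfl⟩
  rw [map_mul, map_inv, mul_inv_eq_one, map_mul] at h
  exact h

/-- The homomorphism to a group in which the relations of the table hold. -/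
def lift {P : Type*} [Group P] (g : Fin 6 → P)
    (h : ∀ i j, g i * g j = FreeGroup.lift g (T i j)) : TableGroup T →* P :=
  PresentedGroup.toGroup (f := g) <| by
    rintro _ ⟨i, j, rfl⟩
    simp [h]

@[simp] lemma lift_of {P : Type*} [Group P] (g : Fin 6 → P)
    (h : ∀ i j, g i * g j = FreeGroup.lift g (T i j)) (i : Fin 6) :
    lift g h (PresentedGroup.of i) = g i :=
  PresentedGroup.toGroup.of _

end TableGroup

/-! ### Identification of the presented groups with their models -/

namespace PcModel

lemma Relations.table₁ {P : Type*} [Group P] {g : Fin 6 → P} (h : Relations 0 g) (i j : Fin 6) :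
    g i * g j = FreeGroup.lift g (table₁ i j) := by
  have h0 : g 0 * g 0 = g 4 := h.sq_zero.trans (pow_one _)
  have h2 : g 2 * g 2 = 1 := h.sq_two.trans (pow_zero _)
  have h3 : g 3 * g 3 = 1 := h.sq_three.trans (pow_zero _)
  -- Entries above the diagonal are tautological; the others are the listed relations.
  fin_cases i <;> fin_cases j <;>
    first
      | (simp [_root_.table₁, Fin.ofNat]; done)
      | simp [_root_.table₁, Fin.ofNat, h0, h2, h3, h.sq_one, h.sq_four, h.sq_five, h.one_zero,
          h.two_zero, h.two_one, h.three_zero, h.three_one, h.three_two, h.four_zero, h.four_one,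
          h.four_two, h.four_three, h.five_zero, h.five_one, h.five_two, h.five_three,
          h.five_four]

lemma Relations.table₂ {P : Type*} [Group P] {g : Fin 6 → P} (h : Relations 1 g) (i j : Fin 6) :
    g i * g j = FreeGroup.lift g (table₂ i j) := by
  have h0 : g 0 * g 0 = 1 := h.sq_zero.trans (pow_zero _)
  have h2 : g 2 * g 2 = g 4 := h.sq_two.trans (pow_one _)
  have h3 : g 3 * g 3 = g 4 := h.sq_three.trans (pow_one _)
  fin_cases i <;> fin_cases j <;>
    first
      | (simp [_root_.table₂, Fin.ofNat]; done)
      | simp [_root_.table₂, Fin.ofNat, h0, h2, h3, h.sq_one, h.sq_four, h.sq_five, h.one_zero,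
          h.two_zero, h.two_one, h.three_zero, h.three_one, h.three_two, h.four_zero, h.four_one,
          h.four_two, h.four_three, h.five_zero, h.five_one, h.five_two, h.five_three,
          h.five_four]

lemma relations_groupOne : Relations 0 (PresentedGroup.of : Fin 6 → GroupOne) where
  sq_zero := TableGroup.mk_mul_mk table₁ 0 0
  sq_one := TableGroup.mk_mul_mk table₁ 1 1
  sq_two := TableGroup.mk_mul_mk table₁ 2 2
  sq_three := TableGroup.mk_mul_mk table₁ 3 3
  sq_four := TableGroup.mk_mul_mk table₁ 4 4
  sq_five := TableGroup.mk_mul_mk table₁ 5 5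
  one_zero := TableGroup.mk_mul_mk table₁ 1 0
  two_zero := TableGroup.mk_mul_mk table₁ 2 0
  two_one := TableGroup.mk_mul_mk table₁ 2 1
  three_zero := TableGroup.mk_mul_mk table₁ 3 0
  three_one := TableGroup.mk_mul_mk table₁ 3 1
  three_two := TableGroup.mk_mul_mk table₁ 3 2
  four_zero := TableGroup.mk_mul_mk table₁ 4 0
  four_one := TableGroup.mk_mul_mk table₁ 4 1
  four_two := TableGroup.mk_mul_mk table₁ 4 2
  four_three := TableGroup.mk_mul_mk table₁ 4 3
  five_zero := TableGroup.mk_mul_mk table₁ 5 0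
  five_one := TableGroup.mk_mul_mk table₁ 5 1
  five_two := TableGroup.mk_mul_mk table₁ 5 2
  five_three := TableGroup.mk_mul_mk table₁ 5 3
  five_four := TableGroup.mk_mul_mk table₁ 5 4

lemma relations_groupTwo : Relations 1 (PresentedGroup.of : Fin 6 → GroupTwo) where
  sq_zero := TableGroup.mk_mul_mk table₂ 0 0
  sq_one := TableGroup.mk_mul_mk table₂ 1 1
  sq_two := TableGroup.mk_mul_mk table₂ 2 2
  sq_three := TableGroup.mk_mul_mk table₂ 3 3
  sq_four := TableGroup.mk_mul_mk table₂ 4 4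
  sq_five := TableGroup.mk_mul_mk table₂ 5 5
  one_zero := TableGroup.mk_mul_mk table₂ 1 0
  two_zero := TableGroup.mk_mul_mk table₂ 2 0
  two_one := TableGroup.mk_mul_mk table₂ 2 1
  three_zero := TableGroup.mk_mul_mk table₂ 3 0
  three_one := TableGroup.mk_mul_mk table₂ 3 1
  three_two := TableGroup.mk_mul_mk table₂ 3 2
  four_zero := TableGroup.mk_mul_mk table₂ 4 0
  four_one := TableGroup.mk_mul_mk table₂ 4 1
  four_two := TableGroup.mk_mul_mk table₂ 4 2
  four_three := TableGroup.mk_mul_mk table₂ 4 3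
  five_zero := TableGroup.mk_mul_mk table₂ 5 0
  five_one := TableGroup.mk_mul_mk table₂ 5 1
  five_two := TableGroup.mk_mul_mk table₂ 5 2
  five_three := TableGroup.mk_mul_mk table₂ 5 3
  five_four := TableGroup.mk_mul_mk table₂ 5 4

/-- A group presented by a table is the model, if the table is equivalent to the relations. -/
def equivOfRelations {T : Fin 6 → Fin 6 → FreeGroup (Fin 6)} (s : ZMod 2)
    (h : Relations s (PresentedGroup.of : Fin 6 → TableGroup T))
    (h' : ∀ i j, gens i * gens j = FreeGroup.lift (gens (s := s)) (T i j)) :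
    TableGroup T ≃* PcModel s :=
  MonoidHom.toMulEquiv (TableGroup.lift gens h') (wordHom h)
    (PresentedGroup.ext fun i => by simpa [wordHom] using word_gens i)
    (MonoidHom.eq_of_eqOn_dense closure_gens <| by
      rintro _ ⟨i, rfl⟩
      simp [wordHom, word_gens])

/-- `G₁` is its model. -/
def equivOne : GroupOne ≃* PcModel 0 :=
  equivOfRelations 0 relations_groupOne relations_gens.table₁

/-- `G₂` is its model. -/
def equivTwo : GroupTwo ≃* PcModel 1 :=
  equivOfRelations 1 relations_groupTwo relations_gens.table₂

@[simp] lemma equivOne_of (i : Fin 6) : equivOne (PresentedGroup.of i) = gens i :=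
  TableGroup.lift_of gens relations_gens.table₁ i

/-! ### Order lists -/

lemma sort_divisors : (Nat.divisors 64).sort (· ≤ ·) = [1, 2, 4, 8, 16, 32, 64] := by
  have h : Nat.divisors 64 = [1, 2, 4, 8, 16, 32, 64].toFinset := by decide +kernel
  rw [h, List.toFinset_sort (r := (· ≤ ·)) (by decide)]
  decide

lemma card_orderOf_eq {A B : Type*} [Group A] [Group B] (e : A ≃* B) (n : ℕ) :
    Nat.card {a : A // orderOf a = n} = Nat.card {b : B // orderOf b = n} :=
  Nat.card_congr <| e.toEquiv.subtypeEquiv fun a => by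
    simp

/-- Squares have vanishing first four coordinates, so they lie in ⟨f₅, f₆⟩, which has exponent two.
-/
lemma pow_four_eq_one {s : ZMod 2} (x : PcModel s) : x ^ 4 = 1 := by
  have h : x * x * (x * x) = 1 := by
    revert x
    induction s using exists_zmod_two <;> decide +kernel
  rw [← h, show 4 = 2 * 2 from rfl, pow_mul, pow_two, pow_two]

lemma orderOf_eq_two_iff {G : Type*} [Group G] (x : G) : orderOf x = 2 ↔ x ≠ 1 ∧ x * x = 1 := by
  constructor
  · intro h
    refine ⟨fun hx => by simp [hx] at h, ?_⟩
    rw [← pow_two, ← h, pow_orderOf_eq_one]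
  · rintro ⟨h1, h2⟩
    exact orderOf_eq_prime (by rw [pow_two, h2]) h1

lemma orderOf_eq_four_iff {s : ZMod 2} (x : PcModel s) : orderOf x = 4 ↔ x * x ≠ 1 := by
  constructor
  · intro h hx
    have := orderOf_dvd_of_pow_eq_one ((pow_two x).trans hx)
    rw [h] at this
    omega
  · intro h
    exact orderOf_eq_prime_pow (p := 2) (n := 1) (by rwa [pow_one, pow_two]) (pow_four_eq_one x)

lemma card_orderOf_eq_zero {s : ZMod 2} {n : ℕ} (hn : 4 < n) :
    Nat.card {x : PcModel s // orderOf x = n} = 0 := by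
  have : IsEmpty {x : PcModel s // orderOf x = n} := ⟨fun x => by
    have h := Nat.le_of_dvd (by norm_num) (orderOf_dvd_of_pow_eq_one (pow_four_eq_one x.1))
    rw [x.2] at h
    omega⟩
  exact Nat.card_of_isEmpty

/-- The exponent divides 4, so only the orders 1, 2 and 4 occur; the involutions and the elements
with nontrivial square are counted in the model. -/
lemma orderList_eq {G : Type} [Group G] {s : ZMod 2} (e : G ≃* PcModel s) :
    orderList G = [1, 19, 44, 0, 0, 0, 0] := by
  have h2 : Nat.card {x : PcModel s // orderOf x = 2} = 19 := by
    simp only [orderOf_eq_two_iff, Nat.card_eq_fintype_card, Fintype.card_subtype]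
    clear e
    induction s using exists_zmod_two <;> decide +kernel
  have h4 : Nat.card {x : PcModel s // orderOf x = 4} = 44 := by
    simp only [orderOf_eq_four_iff, Nat.card_eq_fintype_card, Fintype.card_subtype]
    clear e
    induction s using exists_zmod_two <;> decide +kernel
  rw [orderList, Nat.card_congr e.toEquiv, card_eq, sort_divisors]
  simp [-Nat.card_eq_fintype_card, card_orderOf_eq e, h2, h4, card_orderOf_eq_zero]

/-! ### Distinguishing the groups -/

/-- There is a noncentral involution whose centralizer has index two. -/
def HasInvolution (G : Type*) [Group G] : Prop :=
  ∃ x : G, x * x = 1 ∧ (∃ y, x * y ≠ y * x) ∧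
    ∀ y z, x * y ≠ y * x → x * z ≠ z * x → x * (y * z) = y * z * x

lemma HasInvolution.of_mulEquiv {G K : Type*} [Group G] [Group K] (e : G ≃* K)
    (h : HasInvolution G) : HasInvolution K := by
  obtain ⟨x, h1, ⟨y, hy⟩, h2⟩ := h
  refine ⟨e x, by rw [← map_mul, h1, map_one], ⟨e y, fun hxy => hy (e.injective ?_)⟩, ?_⟩
  · rw [map_mul, map_mul, hxy]
  · intro y z
    obtain ⟨y, rfl⟩ := e.surjective y
    obtain ⟨z, rfl⟩ := e.surjective z
    simp only [← map_mul, ne_eq, e.injective.eq_iff]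
    exact h2 y z

/-- The witness is f₃: its commutator with w is f₆ to the power `w.a`, so its centralizer is the
index-two subgroup `a = 0`. -/
lemma hasInvolution_zero : HasInvolution (PcModel 0) := by
  refine ⟨gens 2, by decide, ⟨gens 0, by decide⟩, ?_⟩
  have h : ∀ y : PcModel 0, gens 2 * y ≠ y * gens 2 → y.a = 1 := by decide +kernel
  intro y z hy hz
  replace hy := h y hy
  replace hz := h z hz
  have h' : ∀ y : PcModel 0, y.a = 0 → gens 2 * y = y * gens 2 := by decide +kernel
  refine h' _ ?_
  simp only [mul_def, hy, hz]
  decide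

lemma not_hasInvolution_one : ¬ HasInvolution (PcModel 1) := by
  rintro ⟨x, hx, ⟨w, hw⟩, h⟩
  -- Two generators outside the centralizer whose product is also outside show that the index
  -- exceeds two. It is enough to test generators, which keeps the enumeration small.
  have key : ∀ x : PcModel 1, x * x = 1 → (∀ i, x * gens i = gens i * x) ∨
      ∃ i j, x * gens i ≠ gens i * x ∧ x * gens j ≠ gens j * x ∧
        x * (gens i * gens j) ≠ gens i * gens j * x := by
    decide +kernel
  rcases key x hx with h1 | ⟨i, j, hi, hj, hij⟩
  · apply hw
    have : Subgroup.closure (Set.range (gens (s := 1))) ≤ Subgroup.centralizer {x} := by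
      rw [Subgroup.closure_le]
      rintro _ ⟨i, rfl⟩
      exact Subgroup.mem_centralizer_singleton_iff.2 (h1 i).symm
    rw [closure_gens] at this
    exact (Subgroup.mem_centralizer_singleton_iff.1 (this (Subgroup.mem_top w))).symm
  · exact hij (h _ _ hi hj)

lemma isEmpty_groupOne_mulEquiv_groupTwo : IsEmpty (GroupOne ≃* GroupTwo) :=
  ⟨fun e => not_hasInvolution_one
    (hasInvolution_zero.of_mulEquiv (equivOne.symm.trans (e.trans equivTwo)))⟩

end PcModel

/-! ### The dual projections of a finite abelian subgroup -/

/-- Characters of a finite abelian group as complex additive characters. -/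
noncomputable def charGroupEquiv (A : Type) [CommGroup A] [Finite A] :
    CharGroup A ≃ AddChar (Additive A) ℂ :=
  (AddChar.toMonoidHomEquiv (A := Additive A) (M := Circle)).symm.trans
    AddChar.circleEquivComplex.toEquiv

instance CharGroup.finite (A : Type) [Group A] [IsMulCommutative A] [Finite A] :
    Finite (CharGroup A) :=
  letI : CommGroup A := { (inferInstance : Group A) with mul_comm := mul_comm' }
  Finite.of_equiv _ (charGroupEquiv A).symm

lemma sum_charGroup {A : Type} [Group A] [IsMulCommutative A] [Fintype A] [DecidableEq A]
    [Fintype (CharGroup A)] (a : A) :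
    ∑ σ : CharGroup A, (σ a : ℂ) = if a = 1 then (Fintype.card A : ℂ) else 0 := by
  let : CommGroup A := { (inferInstance : Group A) with mul_comm := mul_comm' }
  refine (Equiv.sum_comp (charGroupEquiv A) fun ψ => ψ (Additive.ofMul a)).trans ?_
  rw [AddChar.sum_apply_eq_ite]
  exact if_congr Iff.rfl (congrArg _ (Fintype.card_congr Additive.toMul)) rfl

section DualProj

variable {G : Type} [Group G] {N : Subgroup G}

lemma dualProj_eq_sum [Fintype N] (σ : CharGroup N) :
    dualProj N σ = ∑ n : N, MonoidAlgebra.single (n : G)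
      ((Fintype.card N : ℂ)⁻¹ * star (σ n : ℂ)) := by
  rw [dualProj, finsum_eq_sum_of_fintype, Nat.card_eq_fintype_card]

lemma Circle.star_mul_self (z : Circle) : star (z : ℂ) * z = 1 := by
  rw [Complex.star_def, ← Complex.normSq_eq_conj_mul_self]
  simp

/-- Translation by `n` permutes the terms of the sum, and the coefficient at `m` is `σ n` times the
coefficient at `n * m`. -/
lemma single_mul_dualProj [Fintype N] (n : N) (σ : CharGroup N) :
    MonoidAlgebra.single (n : G) (1 : ℂ) * dualProj N σ = (σ n : ℂ) • dualProj N σ := by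
  rw [dualProj_eq_sum, Finset.mul_sum, Finset.smul_sum,
    ← Equiv.sum_comp (Equiv.mulLeft n) fun m : N => (σ n : ℂ) • MonoidAlgebra.single (m : G)
      ((Fintype.card N : ℂ)⁻¹ * star (σ m : ℂ))]
  refine Finset.sum_congr rfl fun m _ => ?_
  have h := Circle.star_mul_self (σ n)
  simp only [Equiv.coe_mulLeft, Subgroup.coe_mul, map_mul, Circle.coe_mul, star_mul',
    MonoidAlgebra.single_mul_single, one_mul, MonoidAlgebra.smul_single, smul_eq_mul]
  congr 1
  linear_combination (-(Fintype.card N : ℂ)⁻¹ * star (σ m : ℂ)) * h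

/-- The coefficient at `n` is a sum over all characters, which vanishes for `n ≠ 1` by
orthogonality. -/
lemma sum_dualProj [Fintype N] [IsMulCommutative N] [Fintype (CharGroup N)] :
    ∑ σ : CharGroup N, dualProj N σ = 1 := by
  classical
  simp only [dualProj_eq_sum]
  rw [Finset.sum_comm]
  have h (n : N) : ∑ σ : CharGroup N, MonoidAlgebra.single (n : G)
      ((Fintype.card N : ℂ)⁻¹ * star (σ n : ℂ)) = if n = 1 then 1 else 0 := by
    have h1 : ∑ σ : CharGroup N, star (σ n : ℂ) =
        if n = 1 then (Fintype.card N : ℂ) else 0 := by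
      rw [← star_sum, sum_charGroup]
      split_ifs <;> simp
    have h2 : ∑ σ : CharGroup N, MonoidAlgebra.single (n : G)
      ((Fintype.card N : ℂ)⁻¹ * star (σ n : ℂ)) = MonoidAlgebra.single (n : G)
        ((Fintype.card N : ℂ)⁻¹ * ∑ σ : CharGroup N, star (σ n : ℂ)) := by
      rw [Finset.mul_sum]
      exact (map_sum (MonoidAlgebra.singleAddHom (R := ℂ) (n : G)) _ _).symm
    rw [h2, h1]
    split_ifs with hn
    · subst hn
      simp [MonoidAlgebra.one_def]
    · simp
  rw [Finset.sum_congr rfl fun n _ => h n]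
  simp

/-- The coefficient of the action of `dualProj N τ` on a vector of weight `σ`. -/
lemma sum_star_mul [Fintype N] [DecidableEq (CharGroup N)] (σ τ : CharGroup N) :
    ∑ n : N, (Fintype.card N : ℂ)⁻¹ * star (τ n : ℂ) * (σ n : ℂ) = if τ = σ then 1 else 0 := by
  split_ifs with h
  · subst h
    simp only [mul_assoc, Circle.star_mul_self]
    simp
  · obtain ⟨m, hm⟩ : ∃ m, τ m ≠ σ m := by
      by_contra! h'
      exact h (MonoidHom.ext h')
    set S := ∑ n : N, (Fintype.card N : ℂ)⁻¹ * star (τ n : ℂ) * (σ n : ℂ)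
    -- Reindexing by `m` multiplies the sum by a scalar different from one, so the sum is zero.
    have hS : S = star (τ m : ℂ) * σ m * S := by
      rw [Finset.mul_sum]
      refine (Equiv.sum_comp (Equiv.mulLeft m) _).symm.trans ?_
      refine Finset.sum_congr rfl fun n _ => ?_
      simp only [Equiv.coe_mulLeft, map_mul, Circle.coe_mul, star_mul']
      ring
    have h1 : (τ m : ℂ) * S = σ m * S := by
      conv_lhs => rw [hS]
      linear_combination (σ m * S) * Circle.star_mul_self (τ m)
    by_contra hne
    exact hm (Circle.ext (mul_right_cancel₀ hne h1))

lemma dualProj_mul_dualProj [Fintype N] [DecidableEq (CharGroup N)] (σ τ : CharGroup N) :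
    dualProj N τ * dualProj N σ = if τ = σ then dualProj N σ else 0 := by
  have h (n : N) : MonoidAlgebra.single (n : G) ((Fintype.card N : ℂ)⁻¹ * star (τ n : ℂ)) *
      dualProj N σ = ((Fintype.card N : ℂ)⁻¹ * star (τ n : ℂ) * (σ n : ℂ)) • dualProj N σ := by
    rw [← smul_smul, ← single_mul_dualProj, ← smul_mul_assoc, MonoidAlgebra.smul_single,
      smul_eq_mul, mul_one]
  conv_lhs => rw [dualProj_eq_sum τ, Finset.sum_mul]
  simp only [h]
  rw [← Finset.sum_smul, sum_star_mul]
  split_ifs <;> simp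

lemma groupStar_single (g : G) (c : ℂ) :
    groupStar (MonoidAlgebra.single g c) = MonoidAlgebra.single g⁻¹ (star c) := by
  simp [groupStar]

lemma groupStar_add (a b : MonoidAlgebra ℂ G) : groupStar (a + b) = groupStar a + groupStar b := by
  classical
  simp only [groupStar, MonoidAlgebra.coeff_add]
  exact Finsupp.sum_add_index (by simp) (by simp)

/-- The involution of the group algebra as an additive map. -/
noncomputable def groupStarHom : MonoidAlgebra ℂ G →+ MonoidAlgebra ℂ G where
  toFun := groupStar
  map_zero' := by simp [groupStar]
  map_add' := groupStar_add

lemma groupStar_sum {ι : Type*} (s : Finset ι) (f : ι → MonoidAlgebra ℂ G) :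
    groupStar (∑ i ∈ s, f i) = ∑ i ∈ s, groupStar (f i) :=
  map_sum groupStarHom f s

lemma groupStar_dualProj [Fintype N] (σ : CharGroup N) :
    groupStar (dualProj N σ) = dualProj N σ := by
  rw [dualProj_eq_sum, groupStar_sum, ← Equiv.sum_comp (Equiv.inv N)]
  refine Finset.sum_congr rfl fun n _ => ?_
  simp [groupStar_single, ← Circle.coe_inv_eq_conj]

lemma cocycleElement_eq_sum [Fintype (CharGroup N)] (ω : CharGroup N → CharGroup N → Circle) :
    cocycleElement N ω = ∑ σ : CharGroup N, ∑ τ : CharGroup N,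
      (ω σ τ : ℂ) • (dualProj N σ ⊗ₜ[ℂ] dualProj N τ) := by
  rw [cocycleElement, finsum_eq_sum_of_fintype, Fintype.sum_prod_type]

lemma cocycleElement_mul_tmul [Fintype N] [Fintype (CharGroup N)]
    (ω : CharGroup N → CharGroup N → Circle) (σ τ : CharGroup N) :
    cocycleElement N ω * (dualProj N σ ⊗ₜ[ℂ] dualProj N τ) =
      (ω σ τ : ℂ) • (dualProj N σ ⊗ₜ[ℂ] dualProj N τ) := by
  classical
  rw [cocycleElement_eq_sum, Finset.sum_mul]
  simp only [Finset.sum_mul, smul_mul_assoc, Algebra.TensorProduct.tmul_mul_tmul,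
    dualProj_mul_dualProj]
  rw [Finset.sum_eq_single σ, Finset.sum_eq_single τ]
  · simp
  · intro b _ hb; simp [hb]
  · simp
  · intro b _ hb; simp [hb]
  · simp

/-- The tensors of projections sum to one. Identities in ℂ[G] ⊗ ℂ[G] thereby reduce to scalar
identities indexed by pairs of characters. -/
lemma eq_of_mul_tmul_eq [Fintype N] [IsMulCommutative N]
    {X Y : MonoidAlgebra ℂ G ⊗[ℂ] MonoidAlgebra ℂ G}
    (h : ∀ σ τ : CharGroup N, X * (dualProj N σ ⊗ₜ[ℂ] dualProj N τ) =
      Y * (dualProj N σ ⊗ₜ[ℂ] dualProj N τ)) : X = Y := by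
  have := Fintype.ofFinite (CharGroup N)
  have h1 : (1 : MonoidAlgebra ℂ G ⊗[ℂ] MonoidAlgebra ℂ G) = ∑ σ : CharGroup N,
      ∑ τ : CharGroup N, dualProj N σ ⊗ₜ[ℂ] dualProj N τ := by
    simp only [← TensorProduct.tmul_sum, ← TensorProduct.sum_tmul, sum_dualProj]
    rfl
  rw [← mul_one X, ← mul_one Y, h1]
  simp only [Finset.mul_sum, h]

lemma cocycleElement_inv_mul [Fintype N] [IsMulCommutative N]
    (ω : CharGroup N → CharGroup N → Circle) :
    cocycleElement N (fun σ τ => (ω σ τ)⁻¹) * cocycleElement N ω = 1 := by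
  have := Fintype.ofFinite (CharGroup N)
  refine eq_of_mul_tmul_eq (N := N) fun σ τ => ?_
  rw [mul_assoc, cocycleElement_mul_tmul, mul_smul_comm, cocycleElement_mul_tmul, smul_smul,
    one_mul, ← Circle.coe_mul]
  simp

lemma cocycleElement_mul_inv [Fintype N] [IsMulCommutative N]
    (ω : CharGroup N → CharGroup N → Circle) :
    cocycleElement N ω * cocycleElement N (fun σ τ => (ω σ τ)⁻¹) = 1 := by
  simpa using cocycleElement_inv_mul (N := N) fun σ τ => (ω σ τ)⁻¹

end DualProj

/-! ### The action of the group algebra on a representation -/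

namespace UnitaryRep

variable {G K : Type} [Group G] [Group K]

/-- The action of the group algebra on a representation. -/
noncomputable def act (U : UnitaryRep G) : MonoidAlgebra ℂ G →ₐ[ℂ] Module.End ℂ U.V :=
  MonoidAlgebra.lift ℂ (Module.End ℂ U.V) G
    { toFun := fun g => (U.ρ g).toLinearEquiv.toLinearMap
      map_one' := by ext; simp
      map_mul' := fun g h => by ext; simp }

lemma act_single (U : UnitaryRep G) (g : G) (c : ℂ) (v : U.V) :
    U.act (MonoidAlgebra.single g c) v = c • U.ρ g v := by
  rw [act, MonoidAlgebra.lift_single]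
  rfl

lemma lin_act {U W : UnitaryRep G} (T : U ⟶ W) (a : MonoidAlgebra ℂ G) (v : U.V) :
    lin T (U.act a v) = W.act a (lin T v) := by
  induction a using MonoidAlgebra.induction_linear with
  | zero => simp
  | add a b ha hb => simp [ha, hb]
  | single g c => simp [act_single, lin_comm]

lemma groupStar_smul (c : ℂ) (a : MonoidAlgebra ℂ G) :
    groupStar (c • a) = star c • groupStar a := by
  induction a using MonoidAlgebra.induction_linear with
  | zero => simp [groupStar]
  | add a b ha hb => rw [smul_add, groupStar_add, ha, hb, groupStar_add, smul_add]
  | single g d => simp [groupStar_single]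

lemma groupStar_mul (a b : MonoidAlgebra ℂ G) : groupStar (a * b) = groupStar b * groupStar a := by
  induction a using MonoidAlgebra.induction_linear with
  | zero => simp [groupStar]
  | add a a' ha hb => rw [add_mul, groupStar_add, ha, hb, groupStar_add, mul_add]
  | single g d =>
    induction b using MonoidAlgebra.induction_linear with
    | zero => simp [groupStar]
    | add a a' ha hb => rw [mul_add, groupStar_add, ha, hb, groupStar_add, add_mul]
    | single h e => simp [groupStar_single, MonoidAlgebra.single_mul_single, mul_comm]

lemma adjoint_act (U : UnitaryRep G) (a : MonoidAlgebra ℂ G) :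
    LinearMap.adjoint (U.act a) = U.act (groupStar a) := by
  symm
  rw [LinearMap.eq_adjoint_iff]
  intro v w
  induction a using MonoidAlgebra.induction_linear with
  | zero => simp [groupStar]
  | add a b ha hb => simp [groupStar_add, inner_add_left, inner_add_right, ha, hb]
  | single g c =>
    rw [groupStar_single, act_single, act_single, inner_smul_left, inner_smul_right,
      ← LinearIsometryEquiv.inner_map_map (U.ρ g) (U.ρ g⁻¹ v) w]
    simp

/-! ### Pulling back along a `*`-homomorphism of group algebras -/

/-- The unitary given by the image of a group element. -/
noncomputable def pullbackUnitary (Φ : MonoidAlgebra ℂ K →ₐ[ℂ] MonoidAlgebra ℂ G)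
    (hΦ : ∀ a, Φ (groupStar a) = groupStar (Φ a)) (U : UnitaryRep G) : K →* (U.V ≃ₗᵢ[ℂ] U.V) where
  toFun k := LinearEquiv.isometryOfInner
    (LinearEquiv.ofLinearMap (U.act (Φ (MonoidAlgebra.single k 1)))
      (U.act (Φ (MonoidAlgebra.single k⁻¹ 1)))
      (by
        rw [← Module.End.mul_eq_comp, ← map_mul, ← map_mul, MonoidAlgebra.single_mul_single]
        simp [← MonoidAlgebra.one_def, Module.End.one_eq_id])
      (by
        rw [← Module.End.mul_eq_comp, ← map_mul, ← map_mul, MonoidAlgebra.single_mul_single]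
        simp [← MonoidAlgebra.one_def, Module.End.one_eq_id]))
    (fun v w => by
      simp only [LinearEquiv.coe_ofLinearMap]
      rw [← LinearMap.adjoint_inner_right, adjoint_act, ← hΦ, groupStar_single,
        ← Module.End.mul_apply, ← map_mul, ← map_mul, MonoidAlgebra.single_mul_single]
      simp [← MonoidAlgebra.one_def])
  map_one' := by
    ext v
    simp [← MonoidAlgebra.one_def]
  map_mul' k l := by
    ext v
    have h : MonoidAlgebra.single (k * l) (1 : ℂ) =
      MonoidAlgebra.single k 1 * MonoidAlgebra.single l 1 := by
      rw [MonoidAlgebra.single_mul_single, one_mul]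
    change U.act (Φ (MonoidAlgebra.single (k * l) 1)) v = _
    rw [h, map_mul, map_mul]
    rfl

/-- The representation of `K` on the space of a representation `U` of `G` given by a
`*`-homomorphism of group algebras. -/
noncomputable abbrev pullbackObj (Φ : MonoidAlgebra ℂ K →ₐ[ℂ] MonoidAlgebra ℂ G)
    (hΦ : ∀ a, Φ (groupStar a) = groupStar (Φ a)) (U : UnitaryRep G) : UnitaryRep K where
  V := U.V
  ρ := pullbackUnitary Φ hΦ U

variable (Φ : MonoidAlgebra ℂ K →ₐ[ℂ] MonoidAlgebra ℂ G)
  (hΦ : ∀ a, Φ (groupStar a) = groupStar (Φ a))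

lemma pullbackObj_ρ (U : UnitaryRep G) (k : K) (v : U.V) :
    (pullbackObj Φ hΦ U).ρ k v = U.act (Φ (MonoidAlgebra.single k 1)) v := rfl

lemma act_pullbackObj (U : UnitaryRep G) (b : MonoidAlgebra ℂ K) (v : U.V) :
    (pullbackObj Φ hΦ U).act b v = U.act (Φ b) v := by
  induction b using MonoidAlgebra.induction_linear with
  | zero => simp
  | add a b ha hb => simp [ha, hb]
  | single k c =>
    have h : MonoidAlgebra.single k c = c • MonoidAlgebra.single k (1 : ℂ) := by simp
    rw [act_single, pullbackObj_ρ, h, map_smul, map_smul]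
    rfl

/-- The functor on representations given by a `*`-homomorphism of group algebras. -/
noncomputable def pullback : UnitaryRep G ⥤ UnitaryRep K where
  obj := pullbackObj Φ hΦ
  map {U W} T := homMk (U := pullbackObj Φ hΦ U) (W := pullbackObj Φ hΦ W)
    (lin (U := U) (W := W) T) fun _ v => lin_act (U := U) (W := W) T _ v
  map_id _ := rfl
  map_comp _ _ := rfl

lemma pullback_map_dag {U W : UnitaryRep G} (T : U ⟶ W) :
    (pullback Φ hΦ).map (dag T) = dag ((pullback Φ hΦ).map T) := rfl

/-! ### Unitary morphisms -/

lemma dag_comp {U W X : UnitaryRep G} (S : U ⟶ W) (T : W ⟶ X) : dag (S ≫ T) = dag T ≫ dag S :=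
  hom_ext (LinearMap.adjoint_comp (lin T) (lin S))

lemma dag_dag {U W : UnitaryRep G} (T : U ⟶ W) : dag (dag T) = T :=
  hom_ext (LinearMap.adjoint_adjoint (lin T))

lemma IsUnitaryHom.comp {U W X : UnitaryRep G} {S : U ⟶ W} {T : W ⟶ X} (hS : IsUnitaryHom S)
    (hT : IsUnitaryHom T) : IsUnitaryHom (S ≫ T) := by
  constructor
  · rw [dag_comp, Category.assoc, ← Category.assoc T, hT.1, Category.id_comp, hS.1]
  · rw [dag_comp, Category.assoc, ← Category.assoc (dag S), hS.2, Category.id_comp, hT.2]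

lemma IsUnitaryHom.dag {U W : UnitaryRep G} {S : U ⟶ W} (hS : IsUnitaryHom S) :
    IsUnitaryHom (dag S) := by
  rw [IsUnitaryHom, dag_dag]
  exact ⟨hS.2, hS.1⟩

/-- A one-sided inverse of a unitary is its adjoint. This handles the inverse structure maps, for
which no formula is needed. -/
lemma IsUnitaryHom.of_comp_eq_id {U W : UnitaryRep G} {S : U ⟶ W} {T : W ⟶ U}
    (hS : IsUnitaryHom S) (h : S ≫ T = 𝟙 U) : IsUnitaryHom T := by
  have : T = UnitaryRep.dag S := by
    rw [← Category.id_comp T, ← hS.2, Category.assoc, h, Category.comp_id]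
  rw [this]
  exact hS.dag

/-- Source and target are the same Hilbert space with possibly different actions, so the adjoint of
the identity map is again the identity. -/
lemma IsUnitaryHom.of_lin_eq_id {U : UnitaryRep G} {ρ : G →* (U.V ≃ₗᵢ[ℂ] U.V)}
    {S : U ⟶ { V := U.V, ρ := ρ }} (hS : lin S = LinearMap.id) : IsUnitaryHom S := by
  have h : lin (UnitaryRep.dag S) = LinearMap.id :=
    (congrArg LinearMap.adjoint hS).trans (LinearMap.adjoint_id)
  constructor <;> refine hom_ext ?_ <;> rw [lin_comp, h, hS] <;> rfl

lemma IsUnitaryHom.tensorMap {U U' W W' : UnitaryRep G} {S : U ⟶ U'} {T : W ⟶ W'}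
    (hS : IsUnitaryHom S) (hT : IsUnitaryHom T) : IsUnitaryHom (S ⊗ₘ T) := by
  have h : UnitaryRep.dag (S ⊗ₘ T) = UnitaryRep.dag S ⊗ₘ UnitaryRep.dag T :=
    hom_ext (TensorProduct.adjoint_map (lin S) (lin T))
  constructor
  · rw [h, tensorHom_comp_tensorHom, hS.1, hT.1, id_tensorHom_id]
  · rw [h, tensorHom_comp_tensorHom, hS.2, hT.2, id_tensorHom_id]

lemma IsUnitaryHom.pullback_map {U W : UnitaryRep G} {T : U ⟶ W} (hT : IsUnitaryHom T) :
    IsUnitaryHom ((pullback Φ hΦ).map T) := by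
  rw [IsUnitaryHom, ← pullback_map_dag, ← Functor.map_comp, ← Functor.map_comp, hT.1, hT.2]
  exact ⟨rfl, rfl⟩

end UnitaryRep

namespace UnitaryRep

variable {G K : Type} [Group G] [Group K]

/-! ### Weight vectors for an abelian subgroup -/

/-- The vector `u` is an eigenvector of `N` with character `σ`. -/
def HasWeight {N : Subgroup G} (U : UnitaryRep G) (σ : CharGroup N) (u : U.V) : Prop :=
  ∀ n : N, U.ρ (n : G) u = (σ n : ℂ) • u

variable {N : Subgroup G}

lemma hasWeight_act_dualProj [Fintype N] (U : UnitaryRep G) (σ : CharGroup N) (u : U.V) :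
    HasWeight U σ (U.act (dualProj N σ) u) := fun n => by
  rw [← one_smul ℂ (U.ρ n _), ← act_single, ← Module.End.mul_apply, ← map_mul,
    single_mul_dualProj, map_smul]
  rfl

lemma HasWeight.act_dualProj [Fintype N] [DecidableEq (CharGroup N)] {U : UnitaryRep G}
    {σ : CharGroup N} {u : U.V} (h : HasWeight U σ u) (τ : CharGroup N) :
    U.act (dualProj N τ) u = if τ = σ then u else 0 := by
  have h' (n : N) : U.act (MonoidAlgebra.single (n : G)
      ((Fintype.card N : ℂ)⁻¹ * star (τ n : ℂ))) u =
      ((Fintype.card N : ℂ)⁻¹ * star (τ n : ℂ) * (σ n : ℂ)) • u := by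
    rw [act_single, h n, smul_smul]
  rw [dualProj_eq_sum, map_sum, LinearMap.sum_apply, Finset.sum_congr rfl fun n _ => h' n,
    ← Finset.sum_smul, sum_star_mul]
  split_ifs <;> simp

lemma HasWeight.tensor {U W : UnitaryRep G} {σ τ : CharGroup N} {u : U.V} {w : W.V}
    (hu : HasWeight U σ u) (hw : HasWeight W τ w) :
    HasWeight (tensor U W) (σ * τ) (u ⊗ₜ[ℂ] w) := fun n => by
  change U.ρ (n : G) u ⊗ₜ[ℂ] W.ρ (n : G) w = _
  rw [hu, hw, TensorProduct.smul_tmul_smul]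
  simp

lemma HasWeight.lin {U W : UnitaryRep G} {σ : CharGroup N} {u : U.V} (hu : HasWeight U σ u)
    (T : U ⟶ W) : HasWeight W σ (lin T u) := fun n => by
  rw [← lin_comm, hu, map_smul]

lemma hasWeight_triv (c : ℂ) : HasWeight (N := N) (triv G) 1 c := fun n => by
  simp

section

variable [Fintype N] [IsMulCommutative N]

/-- The projections `dualProj N σ` sum to one and map into the weight spaces. Hence linear maps on
representations, and on their tensor products, may be compared on weight vectors. -/
lemma mem_span_hasWeight (U : UnitaryRep G) (u : U.V) :
    u ∈ Submodule.span ℂ {v | ∃ σ : CharGroup N, HasWeight U σ v} := by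
  have := Fintype.ofFinite (CharGroup N)
  have h : u = ∑ σ : CharGroup N, U.act (dualProj N σ) u := by
    rw [← LinearMap.sum_apply, ← map_sum, sum_dualProj]
    simp
  rw [h]
  exact Submodule.sum_mem _ fun σ _ => Submodule.subset_span ⟨σ, hasWeight_act_dualProj U σ u⟩

lemma linearMap_ext_of_hasWeight (N : Subgroup G) [Fintype N] [IsMulCommutative N]
    {U : UnitaryRep G} {X : Type*} [AddCommMonoid X] [Module ℂ X] {S T : U.V →ₗ[ℂ] X}
    (h : ∀ (σ : CharGroup N) (u : U.V), HasWeight U σ u → S u = T u) : S = T := by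
  refine LinearMap.ext fun u => ?_
  have hu := mem_span_hasWeight (N := N) U u
  induction hu using Submodule.span_induction with
  | mem v hv => obtain ⟨σ, hσ⟩ := hv; exact h σ v hσ
  | zero => simp
  | add v w _ _ hv hw => simp [hv, hw]
  | smul c v _ hv => simp [hv]

lemma tensor_ext_of_hasWeight (N : Subgroup G) [Fintype N] [IsMulCommutative N]
    {U W : UnitaryRep G} {X : Type*} [AddCommMonoid X] [Module ℂ X]
    {S T : U.V ⊗[ℂ] W.V →ₗ[ℂ] X}
    (h : ∀ (σ τ : CharGroup N) (u : U.V) (w : W.V), HasWeight U σ u → HasWeight W τ w →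
      S (u ⊗ₜ w) = T (u ⊗ₜ w)) : S = T := by
  refine TensorProduct.ext ?_
  refine linearMap_ext_of_hasWeight N fun σ u hu => ?_
  refine linearMap_ext_of_hasWeight N fun τ w hw => ?_
  exact h σ τ u w hu hw

lemma tensor_tensor_ext_of_hasWeight (N : Subgroup G) [Fintype N] [IsMulCommutative N]
    {U W X : UnitaryRep G} {Y : Type*} [AddCommMonoid Y] [Module ℂ Y]
    {S T : (U.V ⊗[ℂ] W.V) ⊗[ℂ] X.V →ₗ[ℂ] Y}
    (h : ∀ (ρ σ τ : CharGroup N) (u : U.V) (w : W.V) (x : X.V), HasWeight U ρ u →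
      HasWeight W σ w → HasWeight X τ x → S (u ⊗ₜ w ⊗ₜ x) = T (u ⊗ₜ w ⊗ₜ x)) : S = T := by
  refine TensorProduct.ext ?_
  refine tensor_ext_of_hasWeight N fun ρ σ u w hu hw => ?_
  refine linearMap_ext_of_hasWeight N fun τ x hx => ?_
  exact h ρ σ τ u w x hu hw hx

end

/-! ### The action of the tensor square of the group algebra -/

/-- The action of `ℂ[G] ⊗ ℂ[G]` on a tensor product of representations. -/
noncomputable def actTensor (U W : UnitaryRep G) :
    MonoidAlgebra ℂ G ⊗[ℂ] MonoidAlgebra ℂ G →ₐ[ℂ] Module.End ℂ (U.V ⊗[ℂ] W.V) :=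
  (Module.endTensorEndAlgHom (R := ℂ) (S := ℂ) (A := ℂ)).comp
    (Algebra.TensorProduct.map U.act W.act)

lemma actTensor_tmul (U W : UnitaryRep G) (a b : MonoidAlgebra ℂ G) (u : U.V) (w : W.V) :
    U.actTensor W (a ⊗ₜ b) (u ⊗ₜ w) = U.act a u ⊗ₜ W.act b w := rfl

lemma actTensor_comul (U W : UnitaryRep G) (a : MonoidAlgebra ℂ G) :
    U.actTensor W (Coalgebra.comul (R := ℂ) a) = (tensor U W).act a := by
  refine TensorProduct.ext' fun u w => ?_
  induction a using MonoidAlgebra.induction_linear with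
  | zero => simp
  | add a b ha hb => rw [map_add, map_add, LinearMap.add_apply, ha, hb, map_add]; rfl
  | single g c =>
    rw [act_single, MonoidAlgebra.comul_single, CommSemiring.comul_apply]
    simp only [TensorProduct.map_tmul, MonoidAlgebra.lsingle_apply]
    rw [actTensor_tmul, act_single, act_single, one_smul, TensorProduct.tmul_smul]
    rfl

lemma actTensor_map (Φ : MonoidAlgebra ℂ K →ₐ[ℂ] MonoidAlgebra ℂ G)
    (hΦ : ∀ a, Φ (groupStar a) = groupStar (Φ a)) (U W : UnitaryRep G)
    (t : MonoidAlgebra ℂ K ⊗[ℂ] MonoidAlgebra ℂ K) (x : U.V ⊗[ℂ] W.V) :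
    (pullbackObj Φ hΦ U).actTensor (pullbackObj Φ hΦ W) t x =
      U.actTensor W (TensorProduct.map Φ.toLinearMap Φ.toLinearMap t) x := by
  induction t with
  | zero => simp
  | add a b ha hb => simp only [map_add, LinearMap.add_apply, ha, hb]
  | tmul a b =>
    induction x with
    | zero => simp
    | add a b ha hb => simp only [map_add, ha, hb]
    | tmul u w =>
      rw [TensorProduct.map_tmul, actTensor_tmul, actTensor_tmul, act_pullbackObj, act_pullbackObj]
      rfl

/-- On a tensor of weight vectors only the projections for the pair (σ, τ) survive. -/
lemma actTensor_cocycleElement [Fintype N] [IsMulCommutative N] (U W : UnitaryRep G)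
    (ω : CharGroup N → CharGroup N → Circle) {σ τ : CharGroup N} {u : U.V} {w : W.V}
    (hu : HasWeight U σ u) (hw : HasWeight W τ w) :
    U.actTensor W (cocycleElement N ω) (u ⊗ₜ w) = (ω σ τ : ℂ) • u ⊗ₜ[ℂ] w := by
  classical
  have := Fintype.ofFinite (CharGroup N)
  rw [cocycleElement_eq_sum]
  simp only [map_sum, map_smul, LinearMap.sum_apply, LinearMap.smul_apply, actTensor_tmul,
    hu.act_dualProj, hw.act_dualProj]
  rw [Finset.sum_eq_single σ, Finset.sum_eq_single τ]
  · simp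
  · intro b _ hb; simp [hb]
  · simp
  · intro b _ hb; simp [hb]
  · simp

/-- The projections are self-adjoint, and conjugation on the circle is inversion; so ω acts
unitarily. -/
lemma adjoint_actTensor_cocycleElement [Fintype N] [IsMulCommutative N] (U W : UnitaryRep G)
    (ω : CharGroup N → CharGroup N → Circle) :
    LinearMap.adjoint (U.actTensor W (cocycleElement N ω)) =
      U.actTensor W (cocycleElement N fun σ τ => (ω σ τ)⁻¹) := by
  have := Fintype.ofFinite (CharGroup N)
  have h (σ τ : CharGroup N) :
      LinearMap.adjoint (U.actTensor W (dualProj N σ ⊗ₜ dualProj N τ)) =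
      U.actTensor W (dualProj N σ ⊗ₜ dualProj N τ) := by
    refine (TensorProduct.adjoint_map (U.act (dualProj N σ)) (W.act (dualProj N τ))).trans ?_
    rw [adjoint_act, adjoint_act, groupStar_dualProj, groupStar_dualProj]
    rfl
  simp only [cocycleElement_eq_sum, map_sum, map_smul, map_smulₛₗ, h, Circle.coe_inv_eq_conj]

end UnitaryRep

/-! ### Twisting by a cocycle gives a monoidal equivalence -/

/-- A `*`-isomorphism of group algebras which intertwines the coproduct of `ℂ[K]` with the
coproduct of `ℂ[G]` twisted by a normalized cocycle. -/
structure IsTwistIso {G K : Type} [Group G] [Group K] (N : Subgroup G)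
    (ω : CharGroup N → CharGroup N → Circle)
    (Φ : MonoidAlgebra ℂ K ≃ₐ[ℂ] MonoidAlgebra ℂ G) : Prop where
  star : ∀ a, Φ.toAlgHom (groupStar a) = groupStar (Φ.toAlgHom a)
  comul : ∀ a, twistedComul N ω (Φ a) =
    TensorProduct.map Φ.toLinearMap Φ.toLinearMap (Coalgebra.comul (R := ℂ) a)
  counit : ∀ k, Coalgebra.counit (R := ℂ) (Φ (MonoidAlgebra.single k 1)) = (1 : ℂ)
  cocycle : IsTwoCocycle ω
  one_left : ∀ σ, ω 1 σ = 1
  one_right : ∀ σ, ω σ 1 = 1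

namespace IsTwistIso

open UnitaryRep

variable {G K : Type} [Group G] [Group K] {N : Subgroup G}
  {ω : CharGroup N → CharGroup N → Circle} {Φ : MonoidAlgebra ℂ K ≃ₐ[ℂ] MonoidAlgebra ℂ G}

lemma symm_star (h : IsTwistIso N ω Φ) (a : MonoidAlgebra ℂ G) :
    Φ.symm.toAlgHom (groupStar a) = groupStar (Φ.symm.toAlgHom a) := by
  apply Φ.injective
  refine (Φ.apply_symm_apply _).trans ?_
  exact ((h.star (Φ.symm a)).trans (congrArg groupStar (Φ.apply_symm_apply a))).symm

/-- The functor from representations of `G` to representations of the twist. -/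
noncomputable abbrev functor (h : IsTwistIso N ω Φ) : UnitaryRep G ⥤ UnitaryRep K :=
  pullback Φ.toAlgHom h.star

/-- The functor from representations of the twist to representations of `G`. -/
noncomputable abbrev inverse (h : IsTwistIso N ω Φ) : UnitaryRep K ⥤ UnitaryRep G :=
  pullback Φ.symm.toAlgHom h.symm_star

variable [Fintype N] [IsMulCommutative N]

/-- With Ω the element given by ω, this is the identity Ω Δ^ω(a) = Δ(a) Ω applied to a tensor
product; it makes Ω a morphism of representations of the twist. -/
lemma actTensor_comm (h : IsTwistIso N ω Φ) (U W : UnitaryRep G) (k : K) (x : U.V ⊗[ℂ] W.V) :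
    U.actTensor W (cocycleElement N ω)
      ((tensor (pullbackObj Φ.toAlgHom h.star U) (pullbackObj Φ.toAlgHom h.star W)).ρ k x) =
    (pullbackObj Φ.toAlgHom h.star (tensor U W)).ρ k (U.actTensor W (cocycleElement N ω) x) := by
  have h1 : (tensor (pullbackObj Φ.toAlgHom h.star U) (pullbackObj Φ.toAlgHom h.star W)).ρ k x =
      U.actTensor W (twistedComul N ω (Φ (MonoidAlgebra.single k 1))) x := by
    have h0 := act_single
      (tensor (pullbackObj Φ.toAlgHom h.star U) (pullbackObj Φ.toAlgHom h.star W)) k 1 x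
    rw [one_smul] at h0
    refine h0.symm.trans ?_
    rw [← actTensor_comul, h.comul]
    exact actTensor_map _ _ _ _ _ _
  have h2 : cocycleElement N ω * twistedComul N ω (Φ (MonoidAlgebra.single k 1)) =
      Coalgebra.comul (R := ℂ) (Φ (MonoidAlgebra.single k 1)) * cocycleElement N ω := by
    rw [twistedComul, ← mul_assoc, ← mul_assoc, cocycleElement_mul_inv, one_mul]
  rw [h1, ← Module.End.mul_apply, ← map_mul, h2, map_mul, Module.End.mul_apply, actTensor_comul]
  rfl

/-- The action of the cocycle on a tensor product, as a linear equivalence. -/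
noncomputable def cocycleEquiv (ω : CharGroup N → CharGroup N → Circle) (U W : UnitaryRep G) :
    U.V ⊗[ℂ] W.V ≃ₗ[ℂ] U.V ⊗[ℂ] W.V :=
  LinearEquiv.ofLinearMap (U.actTensor W (cocycleElement N ω))
    (U.actTensor W (cocycleElement N fun σ τ => (ω σ τ)⁻¹))
    (by rw [← Module.End.mul_eq_comp, ← map_mul, cocycleElement_mul_inv, map_one]; rfl)
    (by rw [← Module.End.mul_eq_comp, ← map_mul, cocycleElement_inv_mul, map_one]; rfl)

/-- The tensor structure given by the cocycle. -/
noncomputable def tensorIso (h : IsTwistIso N ω Φ) (U W : UnitaryRep G) :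
    tensor (pullbackObj Φ.toAlgHom h.star U) (pullbackObj Φ.toAlgHom h.star W) ≅
      pullbackObj Φ.toAlgHom h.star (tensor U W) :=
  isoMk (U := tensor (pullbackObj Φ.toAlgHom h.star U) (pullbackObj Φ.toAlgHom h.star W))
    (W := pullbackObj Φ.toAlgHom h.star (tensor U W)) (cocycleEquiv ω U W)
    fun k => LinearMap.ext fun x => h.actTensor_comm U W k x

lemma lin_tensorIso_hom_apply (h : IsTwistIso N ω Φ) {U W : UnitaryRep G} {σ τ : CharGroup N}
    {u : U.V} {w : W.V} (hu : HasWeight U σ u) (hw : HasWeight W τ w) :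
    lin (h.tensorIso U W).hom (u ⊗ₜ w) = (ω σ τ : ℂ) • u ⊗ₜ[ℂ] w :=
  actTensor_cocycleElement U W ω hu hw

lemma isUnitaryHom_tensorIso (h : IsTwistIso N ω Φ) (U W : UnitaryRep G) :
    IsUnitaryHom (h.tensorIso U W).hom := by
  have h1 : dag (h.tensorIso U W).hom = (h.tensorIso U W).inv :=
    hom_ext (adjoint_actTensor_cocycleElement U W ω)
  rw [IsUnitaryHom, h1]
  exact ⟨Iso.hom_inv_id _, Iso.inv_hom_id _⟩

lemma act_triv (a : MonoidAlgebra ℂ G) (c : ℂ) :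
    (triv G).act a c = Coalgebra.counit (R := ℂ) a * c := by
  induction a using MonoidAlgebra.induction_linear with
  | zero => simp
  | add a b ha hb => rw [map_add, map_add, LinearMap.add_apply, ha, hb, add_mul]
  | single g d => rw [act_single, MonoidAlgebra.counit_single]; rfl

/-- The unit structure. -/
noncomputable def unitIso (h : IsTwistIso N ω Φ) :
    triv K ≅ pullbackObj Φ.toAlgHom h.star (triv G) :=
  isoMk (U := triv K) (W := pullbackObj Φ.toAlgHom h.star (triv G)) (LinearEquiv.refl ℂ ℂ)
    fun k => LinearMap.ext fun c => by
      change c = (triv G).act (Φ (MonoidAlgebra.single k 1)) c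
      rw [act_triv, h.counit, one_mul]

/-- The monoidal structure on the functor. -/
noncomputable def coreMonoidal (h : IsTwistIso N ω Φ) : h.functor.CoreMonoidal where
  εIso := h.unitIso
  μIso := h.tensorIso
  μIso_hom_natural_left {U W} T X := by
    refine hom_ext <| tensor_ext_of_hasWeight N (U := U) (W := X) fun σ τ u x hu hx => ?_
    -- Intertwiners preserve weights, so the same scalar appears on both sides.
    refine (h.lin_tensorIso_hom_apply (hu.lin T) hx).trans ?_
    refine Eq.trans ?_ (congrArg (TensorProduct.map (lin T) LinearMap.id)
      (h.lin_tensorIso_hom_apply hu hx)).symm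
    rw [map_smul]
    rfl
  μIso_hom_natural_right {U W} X T := by
    refine hom_ext <| tensor_ext_of_hasWeight N (U := X) (W := U) fun σ τ x u hx hu => ?_
    refine (h.lin_tensorIso_hom_apply hx (hu.lin T)).trans ?_
    refine Eq.trans ?_ (congrArg (TensorProduct.map LinearMap.id (lin T))
      (h.lin_tensorIso_hom_apply hx hu)).symm
    rw [map_smul]
    rfl
  associativity U W X := by
    refine hom_ext <| tensor_tensor_ext_of_hasWeight N (U := U) (W := W) (X := X)
      fun ρ σ τ u w x hu hw hx => ?_
    have l1 := h.lin_tensorIso_hom_apply hu hw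
    have l2 := h.lin_tensorIso_hom_apply (hu.tensor hw) hx
    have r1 := h.lin_tensorIso_hom_apply hw hx
    have r2 := h.lin_tensorIso_hom_apply hu (hw.tensor hx)
    have hl : lin (h.tensorIso (tensor U W) X).hom
        (lin (h.tensorIso U W).hom (u ⊗ₜ w) ⊗ₜ x) =
        ((ω ρ σ : ℂ) * (ω (ρ * σ) τ : ℂ)) • ((u ⊗ₜ w) ⊗ₜ x) := by
      rw [l1]
      refine (congrArg _ (TensorProduct.smul_tmul' (ω ρ σ : ℂ) (u ⊗ₜ[ℂ] w) x).symm).trans ?_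
      rw [map_smul, l2, smul_smul]
    have hr : lin (h.tensorIso U (tensor W X)).hom
        (u ⊗ₜ lin (h.tensorIso W X).hom (w ⊗ₜ x)) =
        ((ω σ τ : ℂ) * (ω ρ (σ * τ) : ℂ)) • (u ⊗ₜ (w ⊗ₜ x)) := by
      rw [r1]
      refine (congrArg _ (TensorProduct.tmul_smul (ω σ τ : ℂ) u (w ⊗ₜ[ℂ] x))).trans ?_
      rw [map_smul, r2, smul_smul]
    -- The two ways of associating produce the two sides of the cocycle identity.
    have hc := congrArg (fun z : Circle => (z : ℂ)) (h.cocycle ρ σ τ)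
    simp only [Circle.coe_mul] at hc
    refine (congrArg (TensorProduct.assoc ℂ U.V W.V X.V) hl).trans ?_
    refine Eq.trans ?_ hr.symm
    rw [map_smul, hc]
    rfl
  left_unitality U := by
    refine hom_ext <| tensor_ext_of_hasWeight N (U := triv G) (W := U) fun σ τ c u _ hu => ?_
    refine Eq.trans ?_ (congrArg (TensorProduct.lid ℂ U.V)
      (h.lin_tensorIso_hom_apply (hasWeight_triv c) hu)).symm
    -- The unit object has trivial weight, so normalization removes the scalar.
    rw [h.one_left, Circle.coe_one, one_smul]
    rfl
  right_unitality U := by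
    refine hom_ext <| tensor_ext_of_hasWeight N (U := U) (W := triv G) fun τ σ u c hu _ => ?_
    refine Eq.trans ?_ (congrArg (TensorProduct.rid ℂ U.V)
      (h.lin_tensorIso_hom_apply hu (hasWeight_triv c))).symm
    rw [h.one_right, Circle.coe_one, one_smul]
    rfl

/-- The unit isomorphism of the equivalence. -/
noncomputable def toPullback (h : IsTwistIso N ω Φ) (U : UnitaryRep G) :
    U ≅ h.inverse.obj (h.functor.obj U) :=
  isoMk (U := U) (W := pullbackObj _ h.symm_star (pullbackObj _ h.star U)) (LinearEquiv.refl ℂ U.V)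
    fun g => LinearMap.ext fun u => by
      change U.ρ g u = (pullbackObj _ h.star U).act (Φ.symm (MonoidAlgebra.single g 1)) u
      rw [act_pullbackObj]
      simp [act_single]

/-- The counit isomorphism of the equivalence. -/
noncomputable def ofPullback (h : IsTwistIso N ω Φ) (W : UnitaryRep K) :
    h.functor.obj (h.inverse.obj W) ≅ W :=
  isoMk (U := pullbackObj _ h.star (pullbackObj _ h.symm_star W)) (W := W) (LinearEquiv.refl ℂ W.V)
    fun k => LinearMap.ext fun w => by
      change (pullbackObj _ h.symm_star W).act (Φ (MonoidAlgebra.single k 1)) w = W.ρ k w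
      rw [act_pullbackObj]
      simp [act_single]

/-- The equivalence of representation categories. -/
noncomputable def equivalence (h : IsTwistIso N ω Φ) : UnitaryRep G ≌ UnitaryRep K where
  functor := h.functor
  inverse := h.inverse
  unitIso := NatIso.ofComponents h.toPullback fun _ => rfl
  counitIso := NatIso.ofComponents h.ofPullback fun _ => rfl
  functor_unitIso_comp _ := rfl

theorem monoidallyEquivalent (h : IsTwistIso N ω Φ) : MonoidallyEquivalent G K := by
  let e := h.equivalence
  let F : e.functor.Monoidal := h.coreMonoidal.toMonoidal
  -- The inverse functor receives the tensor structure forced by the adjunction, which makes unit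
  -- and counit monoidal.
  let F' : e.inverse.Monoidal := e.inverseMonoidal
  have he : e.IsMonoidal := { leftAdjoint_ε := rfl, leftAdjoint_μ := fun _ _ => rfl }
  have hε : IsUnitaryHom (Functor.LaxMonoidal.ε e.functor) :=
    IsUnitaryHom.of_lin_eq_id rfl
  have hμ (U W) : IsUnitaryHom (Functor.LaxMonoidal.μ e.functor U W) :=
    h.isUnitaryHom_tensorIso U W
  have hη : IsUnitaryHom (Functor.OplaxMonoidal.η e.functor) :=
    hε.of_comp_eq_id (Functor.Monoidal.ε_η _)
  have hδ (U W) : IsUnitaryHom (Functor.OplaxMonoidal.δ e.functor U W) :=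
    (hμ U W).of_comp_eq_id (Functor.Monoidal.μ_δ _ _ _)
  have hunit (U) : IsUnitaryHom (e.unitIso.hom.app U) := IsUnitaryHom.of_lin_eq_id rfl
  have hcounit (W) : IsUnitaryHom (e.counitIso.hom.app W) :=
    IsUnitaryHom.of_comp_eq_id (S := e.counitIso.inv.app W) (IsUnitaryHom.of_lin_eq_id rfl)
      (e.counitIso.inv_hom_id_app W)
  refine ⟨e.functor, e.inverse, F, F', e.unitIso, e.counitIso,
    ⟨fun _ _ => rfl, fun _ _ => rfl, fun _ => rfl, hε, hμ⟩,
    ⟨fun _ _ => rfl, fun _ _ => rfl, fun _ => rfl, ?_, fun U W => ?_⟩,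
    inferInstanceAs (NatTrans.IsMonoidal e.unit), inferInstanceAs (NatTrans.IsMonoidal e.counit),
    hunit, hcounit⟩
  -- The transported structure maps of the inverse are composites of units, counits and structure
  -- maps of the functor, all of which are unitary.
  · rw [← e.unitIso_hom_app_comp_inverse_map_η_functor]
    exact (hunit _).comp (hη.pullback_map _ h.symm_star)
  · have h1 : Functor.LaxMonoidal.μ e.inverse U W = e.unitIso.hom.app _ ≫
      e.inverse.map (Functor.OplaxMonoidal.δ e.functor _ _ ≫
        (e.counitIso.hom.app U ⊗ₘ e.counitIso.hom.app W)) :=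
      (Adjunction.IsMonoidal.leftAdjoint_μ (adj := e.toAdjunction) U W).trans
        (e.toAdjunction.homEquiv_unit _ _ _)
    rw [h1]
    exact (hunit _).comp
      (((hδ _ _).comp ((hcounit U).tensorMap (hcounit W))).pullback_map _ h.symm_star)

end IsTwistIso

/-! ### The isomorphism with the Izumi–Kosaki group -/

namespace IzumiKosaki

/-- The matrix `h₁` as an element of `H`. -/
def hOneH : groupH := ⟨hOne, by simp [groupH]⟩

/-- The matrix `h₂` as an element of `H`. -/
def hTwoH : groupH := ⟨hTwo, by simp [groupH]⟩

/-- The images of the generators of `G₁`. -/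
noncomputable def gens : Fin 6 → IzumiKosakiGroup :=
  ![columnVec 1 0 * SemidirectProduct.inr hOneH, columnVec 0 1, SemidirectProduct.inr hTwoH,
    SemidirectProduct.inr hOneH, columnVec 2 0, columnVec 0 2]

/-- Conjugation by f₄ fixes f₁f₄ and multiplies f₂ by (f₁f₄)² = f₅, as h₁ does; conjugation by f₃
acts as h₂; and f₁ = (f₁f₄)f₄. This dictates the images. -/
lemma relations_gens : PcModel.Relations 0 gens := by
  constructor <;> refine SemidirectProduct.ext ?_ (Subtype.ext ?_) <;> decide +kernel

/-- The homomorphism from `G₁` to the Izumi–Kosaki group. -/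
noncomputable def hom : GroupOne →* IzumiKosakiGroup :=
  TableGroup.lift gens relations_gens.table₁

lemma hom_of (i : Fin 6) : hom (PresentedGroup.of i) = gens i := TableGroup.lift_of _ _ i

lemma hom_genOne_mul : hom (genOne 1 * genOne 4) = columnVec 1 0 := by
  refine (map_mul hom (PresentedGroup.of 0) (PresentedGroup.of 3)).trans ?_
  rw [hom_of, hom_of]
  exact SemidirectProduct.ext (by decide +kernel) (Subtype.ext (by decide +kernel))

lemma hom_genOne_two : hom (genOne 2) = columnVec 0 1 := hom_of 1

lemma inl_mem_closure (v : Multiplicative (Fin 2 → ZMod 4)) :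
    (SemidirectProduct.inl v : IzumiKosakiGroup) ∈
      Subgroup.closure {columnVec 1 0, columnVec 0 1} := by
  have h : v = Multiplicative.ofAdd ![1, 0] ^ (v.toAdd 0).val *
      Multiplicative.ofAdd ![0, 1] ^ (v.toAdd 1).val := by
    apply Multiplicative.toAdd.injective
    ext i
    fin_cases i <;> simp
  rw [h, map_mul, map_pow, map_pow]
  exact mul_mem (pow_mem (Subgroup.subset_closure (by simp [columnVec])) _)
    (pow_mem (Subgroup.subset_closure (by simp [columnVec])) _)

lemma closure_eq_range :
    Subgroup.closure {columnVec 1 0, columnVec 0 1} =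
      (SemidirectProduct.inl (φ := actionH)).range := by
  refine le_antisymm ?_ ?_
  · rw [Subgroup.closure_le]
    rintro _ (rfl | rfl)
    exacts [⟨_, rfl⟩, ⟨_, rfl⟩]
  · rintro _ ⟨v, rfl⟩
    exact inl_mem_closure v

lemma map_hom_subgroupN :
    subgroupN.map hom = (SemidirectProduct.inl (φ := actionH)).range := by
  rw [subgroupN, MonoidHom.map_closure, Set.image_insert_eq, Set.image_singleton, hom_genOne_mul,
    hom_genOne_two, closure_eq_range]

lemma inr_mem_range (h : groupH) : (SemidirectProduct.inr h : IzumiKosakiGroup) ∈ hom.range := by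
  have h1 : SemidirectProduct.inr hOneH ∈ hom.range := ⟨_, hom_of 3⟩
  have h2 : SemidirectProduct.inr hTwoH ∈ hom.range := ⟨_, hom_of 2⟩
  obtain ⟨h, rfl | rfl | rfl | rfl⟩ := h
  · have := hom.range.one_mem
    rwa [← map_one SemidirectProduct.inr] at this
  · exact h1
  · exact h2
  · have := mul_mem h1 h2
    rwa [← map_mul] at this

lemma hom_surjective : Function.Surjective hom := by
  rw [← MonoidHom.range_eq_top, Subgroup.eq_top_iff']
  intro x
  rw [← SemidirectProduct.inl_left_mul_inr_right x]
  refine mul_mem ?_ (inr_mem_range _)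
  have h : (SemidirectProduct.inl x.left : IzumiKosakiGroup) ∈ subgroupN.map hom := by
    rw [map_hom_subgroupN]
    exact ⟨_, rfl⟩
  obtain ⟨y, -, hy⟩ := h
  exact ⟨y, hy⟩

lemma card_groupH : Nat.card groupH = 4 := by
  have h : ((groupH : Set (Matrix.SpecialLinearGroup (Fin 2) (ZMod 4)))) =
      (({1, hOne, hTwo, hOne * hTwo} :
        Finset (Matrix.SpecialLinearGroup (Fin 2) (ZMod 4))) : Set _) := by
    simp [groupH]
  change Nat.card (groupH : Set (Matrix.SpecialLinearGroup (Fin 2) (ZMod 4))) = 4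
  rw [h, Nat.card_coe_set_eq, Set.ncard_coe_finset]
  decide +kernel

/-- `G₁` is the Izumi–Kosaki group. -/
noncomputable def equiv : GroupOne ≃* IzumiKosakiGroup :=
  MulEquiv.ofBijective hom <| by
    have hc : Nat.card GroupOne = 64 := by
      rw [Nat.card_congr PcModel.equivOne.toEquiv, PcModel.card_eq]
    have : Finite GroupOne := Nat.finite_of_card_ne_zero (by omega)
    refine (Nat.bijective_iff_surjective_and_card _).2 ⟨hom_surjective, ?_⟩
    rw [hc, SemidirectProduct.card, card_groupH, Nat.card_congr Multiplicative.toAdd]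
    simp

/-! ### Normality of N, coordinates on N and on its dual -/

lemma subgroupN_eq_comap :
    subgroupN = (SemidirectProduct.inl (φ := actionH)).range.comap hom := by
  rw [← map_hom_subgroupN, Subgroup.comap_map_eq_self_of_injective equiv.injective]

/-- N is the preimage of the kernel of the projection of the semidirect product onto H. -/
instance : subgroupN.Normal := by
  rw [subgroupN_eq_comap, SemidirectProduct.range_inl_eq_ker_rightHom]
  infer_instance

/-- The isomorphism of `N` with `C₄ × C₄`. -/
noncomputable def equivN : subgroupN ≃* Multiplicative (Fin 2 → ZMod 4) :=
  (equiv.subgroupMap subgroupN).trans <|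
    (MulEquiv.subgroupCongr map_hom_subgroupN).trans
      (MonoidHom.ofInjective SemidirectProduct.inl_injective).symm

lemma inl_equivN (n : subgroupN) :
    (SemidirectProduct.inl (equivN n) : IzumiKosakiGroup) = hom n :=
  congrArg Subtype.val ((MonoidHom.ofInjective
    (SemidirectProduct.inl_injective (φ := actionH))).apply_symm_apply
      (MulEquiv.subgroupCongr map_hom_subgroupN (equiv.subgroupMap subgroupN n)))

lemma equivN_xN : equivN xN = Multiplicative.ofAdd ![1, 0] :=
  SemidirectProduct.inl_injective ((inl_equivN xN).trans hom_genOne_mul)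

lemma equivN_yN : equivN yN = Multiplicative.ofAdd ![0, 1] :=
  SemidirectProduct.inl_injective ((inl_equivN yN).trans hom_genOne_two)

instance : IsMulCommutative subgroupN :=
  ⟨⟨fun m n => equivN.injective (by rw [map_mul, map_mul, mul_comm])⟩⟩

noncomputable instance : Fintype subgroupN := Fintype.ofEquiv _ equivN.symm.toEquiv

lemma xN_pow_four : xN ^ 4 = 1 := by
  apply equivN.injective
  rw [map_pow, equivN_xN, map_one]
  decide

lemma yN_pow_four : yN ^ 4 = 1 := by
  apply equivN.injective
  rw [map_pow, equivN_yN, map_one]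
  decide

lemma charGroup_ext {σ τ : CharGroup subgroupN} (hx : σ xN = τ xN) (hy : σ yN = τ yN) : σ = τ := by
  ext n
  have h : n = xN ^ ((equivN n).toAdd 0).val * yN ^ ((equivN n).toAdd 1).val := by
    apply equivN.injective
    rw [map_mul, map_pow, map_pow, equivN_xN, equivN_yN]
    apply Multiplicative.toAdd.injective
    ext i
    fin_cases i <;> simp
  rw [h]
  simp [hx, hy]

/-- The imaginary unit on the circle. -/
noncomputable def circleI : Circle := ⟨Complex.I, by simp [Submonoid.unitSphere]⟩

@[simp] lemma coe_circleI : (circleI : ℂ) = Complex.I := rfl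

lemma circleI_pow_four : circleI ^ 4 = 1 := Circle.ext (by simp)

lemma exists_pow_circleI {z : Circle} (hz : z ^ 4 = 1) : ∃ a : ℕ, z = circleI ^ a := by
  have h : (z : ℂ) ^ 4 = 1 := by
    rw [← Circle.coe_pow, hz, Circle.coe_one]
  have h' : ((z : ℂ) - 1) * (z + 1) * (z - Complex.I) * (z + Complex.I) = 0 := by
    linear_combination h - (z ^ 2 - 1) * Complex.I_sq
  rcases mul_eq_zero.1 h' with h1 | h1
  · rcases mul_eq_zero.1 h1 with h2 | h2
    · rcases mul_eq_zero.1 h2 with h3 | h3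
      · exact ⟨0, Circle.ext (by simpa using sub_eq_zero.1 h3)⟩
      · exact ⟨2, Circle.ext (by simpa using eq_neg_of_add_eq_zero_left h3)⟩
    · exact ⟨1, Circle.ext (by simpa using sub_eq_zero.1 h2)⟩
  · exact ⟨3, Circle.ext (by simpa using eq_neg_of_add_eq_zero_left h1)⟩

lemma exists_xN (σ : CharGroup subgroupN) : ∃ a : ℕ, σ xN = circleI ^ a :=
  exists_pow_circleI (by rw [← map_pow, xN_pow_four, map_one])

lemma exists_yN (σ : CharGroup subgroupN) : ∃ a : ℕ, σ yN = circleI ^ a :=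
  exists_pow_circleI (by rw [← map_pow, yN_pow_four, map_one])

/-- The dual basis to (x, y), used as test characters for non-degeneracy. -/
lemma exists_char (i : Fin 2) : ∃ σ : CharGroup subgroupN,
    σ xN = circleI ^ (![1, 0] i : ZMod 4).val ∧ σ yN = circleI ^ (![0, 1] i : ZMod 4).val := by
  let χ : Multiplicative (Fin 2 → ZMod 4) →* Circle :=
    (AddChar.toMonoidHomEquiv (AddChar.zmodChar 4 circleI_pow_four)).comp
      (AddMonoidHom.toMultiplicative (Pi.evalAddMonoidHom (fun _ => ZMod 4) i))
  refine ⟨χ.comp equivN.toMonoidHom, ?_, ?_⟩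
  · change χ (equivN xN) = _
    rw [equivN_xN]
    rfl
  · change χ (equivN yN) = _
    rw [equivN_yN]
    rfl

/-! ### The cocycle -/

/-- The bicharacter `ω(σ, τ) = i^(ab)` for `σ(x) = i^a` and `τ(y) = i^b`. -/
noncomputable def cocycle (σ τ : CharGroup subgroupN) : Circle :=
  circleI ^ ((exists_xN σ).choose * (exists_yN τ).choose)

/-- The value does not depend on the chosen exponents, since i^(ab) is both σ(x)^b and τ(y)^a. -/
lemma cocycle_eq {σ τ : CharGroup subgroupN} {a b : ℕ} (ha : σ xN = circleI ^ a)
    (hb : τ yN = circleI ^ b) : cocycle σ τ = circleI ^ (a * b) := by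
  rw [cocycle, pow_mul, ← (exists_xN σ).choose_spec, ha, ← pow_mul, mul_comm, pow_mul,
    ← (exists_yN τ).choose_spec, hb, ← pow_mul, mul_comm]

lemma cocycle_mul_left (ρ σ τ : CharGroup subgroupN) :
    cocycle (ρ * σ) τ = cocycle ρ τ * cocycle σ τ := by
  obtain ⟨a, ha⟩ := exists_xN ρ
  obtain ⟨b, hb⟩ := exists_xN σ
  obtain ⟨c, hc⟩ := exists_yN τ
  have h : (ρ * σ) xN = circleI ^ (a + b) := by rw [MonoidHom.mul_apply, ha, hb, pow_add]
  rw [cocycle_eq ha hc, cocycle_eq hb hc, cocycle_eq h hc, add_mul, pow_add]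

lemma cocycle_mul_right (ρ σ τ : CharGroup subgroupN) :
    cocycle ρ (σ * τ) = cocycle ρ σ * cocycle ρ τ := by
  obtain ⟨a, ha⟩ := exists_xN ρ
  obtain ⟨b, hb⟩ := exists_yN σ
  obtain ⟨c, hc⟩ := exists_yN τ
  have h : (σ * τ) yN = circleI ^ (b + c) := by rw [MonoidHom.mul_apply, hb, hc, pow_add]
  rw [cocycle_eq ha hb, cocycle_eq ha hc, cocycle_eq ha h, mul_add, pow_add]

lemma cocycle_one_left (τ : CharGroup subgroupN) : cocycle 1 τ = 1 := by
  obtain ⟨b, hb⟩ := exists_yN τ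
  rw [cocycle_eq (a := 0) (by simp) hb, zero_mul, pow_zero]

lemma cocycle_one_right (σ : CharGroup subgroupN) : cocycle σ 1 = 1 := by
  obtain ⟨a, ha⟩ := exists_xN σ
  rw [cocycle_eq (b := 0) ha (by simp), mul_zero, pow_zero]

lemma isTwoCocycle_cocycle : IsTwoCocycle cocycle := fun ρ σ τ => by
  rw [cocycle_mul_left, cocycle_mul_right]
  rw [mul_comm (cocycle σ τ), mul_assoc]

lemma cocycle_of_coe {σ τ : CharGroup subgroupN} {a b : ℕ} (ha : (σ xN : ℂ) = Complex.I ^ a)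
    (hb : (τ yN : ℂ) = Complex.I ^ b) : (cocycle σ τ : ℂ) = Complex.I ^ (a * b) := by
  rw [cocycle_eq (Circle.ext (by simpa using ha)) (Circle.ext (by simpa using hb))]
  simp

lemma isNondegenerate_cocycle : IsNondegenerate cocycle := fun σ h => by
  obtain ⟨a, ha⟩ := exists_xN σ
  obtain ⟨b, hb⟩ := exists_yN σ
  obtain ⟨τ, hτx, hτy⟩ := exists_char 0
  obtain ⟨τ', hτx', hτy'⟩ := exists_char 1
  refine charGroup_ext ?_ ?_
  -- The character with coordinates (0, 1) pairs with σ to i^a on one side and to 1 on the other;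
  -- the character (1, 0) detects b in the same way.
  · have h1 := mul_inv_eq_one.1 (h τ')
    rw [cocycle_eq ha hτy', cocycle_eq hτx' hb] at h1
    rw [ha]
    simpa [ZMod.val_one''] using h1
  · have h1 := mul_inv_eq_one.1 (h τ)
    rw [cocycle_eq ha hτy, cocycle_eq hτx hb] at h1
    rw [hb]
    simpa [ZMod.val_one'', eq_comm] using h1

end IzumiKosaki

namespace IzumiKosaki

open PcModel (equivOne)

/-! ### The action of `G₁` on the dual of `N` -/

/-- Modulo the centralizer of N, `g` is determined by two bits: f₃ contributes to `s` as h₂, while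
f₁ and f₄ contribute to `t` as h₁. -/
lemma exists_conj (g : GroupOne) : ∃ s t : ℕ,
    s = (equivOne g).c.val ∧ t = ((equivOne g).a + (equivOne g).d).val ∧
    (MulAut.conjNormal g xN : subgroupN) = xN * yN ^ (2 * s) ∧
    (MulAut.conjNormal g yN : subgroupN) = yN * xN ^ (2 * t) := by
  have hx : equivOne (xN : GroupOne) = ⟨1, 0, 0, 1, 0, 0⟩ := by
    refine (map_mul equivOne (PresentedGroup.of 0) (PresentedGroup.of 3)).trans ?_
    rw [PcModel.equivOne_of, PcModel.equivOne_of]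
    decide
  have hy : equivOne (yN : GroupOne) = ⟨0, 1, 0, 0, 0, 0⟩ := PcModel.equivOne_of 1
  refine ⟨_, _, rfl, rfl, ?_, ?_⟩
  · apply Subtype.ext
    apply equivOne.injective
    simp only [MulAut.conjNormal_apply, map_mul, map_inv, Subgroup.coe_mul, Subgroup.coe_pow,
      map_pow, hx, hy, pow_mul, pow_two]
    generalize equivOne g = w
    revert w
    decide +kernel
  · apply Subtype.ext
    apply equivOne.injective
    simp only [MulAut.conjNormal_apply, map_mul, map_inv, Subgroup.coe_mul, Subgroup.coe_pow,
      map_pow, hx, hy, pow_mul, pow_two]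
    generalize equivOne g = w
    revert w
    decide +kernel

/-- Expanding (a + 2sb)(d + 2tc), the term in bc is divisible by 4 and disappears; what remains
beyond ad is symmetric in the two characters. -/
lemma cocycle_conjDual (g : GroupOne) : ∃ s t : ℕ,
    s = (equivOne g).c.val ∧ t = ((equivOne g).a + (equivOne g).d).val ∧
    ∀ {σ τ : CharGroup subgroupN} {a b c d : ℕ}, σ xN = circleI ^ a → σ yN = circleI ^ b →
      τ xN = circleI ^ c → τ yN = circleI ^ d →
      cocycle (conjDual subgroupN g σ) (conjDual subgroupN g τ) =
        cocycle σ τ * (circleI ^ (2 * (s * (b * d) + t * (a * c)))) := by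
  obtain ⟨s, t, hs, ht, hx, hy⟩ := exists_conj g
  refine ⟨s, t, hs, ht, fun {σ τ a b c d} ha hb hc hd => ?_⟩
  have h1 : conjDual subgroupN g σ xN = circleI ^ (a + b * (2 * s)) := by
    change σ (MulAut.conjNormal g xN) = _
    rw [hx, map_mul, map_pow, ha, hb, ← pow_mul, ← pow_add]
  have h2 : conjDual subgroupN g τ yN = circleI ^ (d + c * (2 * t)) := by
    change τ (MulAut.conjNormal g yN) = _
    rw [hy, map_mul, map_pow, hc, hd, ← pow_mul, ← pow_add]
  rw [cocycle_eq h1 h2, cocycle_eq ha hd, ← pow_add]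
  have e : (a + b * (2 * s)) * (d + c * (2 * t)) =
      a * d + 2 * (s * (b * d) + t * (a * c)) + 4 * (s * t * b * c) := by ring
  rw [e, pow_add _ _ (4 * _), pow_mul _ 4, circleI_pow_four, one_pow, mul_one]

lemma circleI_pow_mul_self {a b : ℕ} (h : circleI ^ a = circleI ^ b) :
    circleI ^ (a * a) = circleI ^ (b * b) := by
  rw [pow_mul, h, ← pow_mul, mul_comm, pow_mul, h, ← pow_mul]

/-- The function `ξ(σ) = i^(a²)` for `σ(n) = i^a`. -/
noncomputable def squareChar {n : subgroupN}
    (hn : ∀ σ : CharGroup subgroupN, ∃ a : ℕ, σ n = circleI ^ a) (σ : CharGroup subgroupN) :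
    Circle :=
  circleI ^ ((hn σ).choose * (hn σ).choose)

lemma squareChar_eq {n : subgroupN} (hn : ∀ σ : CharGroup subgroupN, ∃ a : ℕ, σ n = circleI ^ a)
    {σ : CharGroup subgroupN} {a : ℕ} (ha : σ n = circleI ^ a) :
    squareChar hn σ = circleI ^ (a * a) :=
  circleI_pow_mul_self ((hn σ).choose_spec.symm.trans ha)

/-- Polarization: (a + c)² - a² - c² = 2ac. This makes the conjugation factor of ω a coboundary. -/
lemma squareChar_mul {n : subgroupN} (hn : ∀ σ : CharGroup subgroupN, ∃ a : ℕ, σ n = circleI ^ a)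
    {σ τ : CharGroup subgroupN} {a c : ℕ} (ha : σ n = circleI ^ a) (hc : τ n = circleI ^ c) :
    squareChar hn (σ * τ) = squareChar hn σ * squareChar hn τ * circleI ^ (2 * (a * c)) := by
  have h : (σ * τ) n = circleI ^ (a + c) := by rw [MonoidHom.mul_apply, ha, hc, pow_add]
  rw [squareChar_eq hn ha, squareChar_eq hn hc, squareChar_eq hn h, ← pow_add, ← pow_add]
  congr 1
  ring

lemma isInvariantCocycle_cocycle : IsInvariantCocycle subgroupN cocycle := fun g => by
  obtain ⟨s, t, -, -, h⟩ := cocycle_conjDual g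
  -- The inverse is needed because a coboundary carries the value at `σ * τ` inverted.
  refine ⟨fun σ => (squareChar exists_yN σ ^ s * squareChar exists_xN σ ^ t)⁻¹, fun σ τ => ?_⟩
  obtain ⟨a, ha⟩ := exists_xN σ
  obtain ⟨b, hb⟩ := exists_yN σ
  obtain ⟨c, hc⟩ := exists_xN τ
  obtain ⟨d, hd⟩ := exists_yN τ
  beta_reduce
  rw [h ha hb hc hd, squareChar_mul exists_yN hb hd, squareChar_mul exists_xN ha hc,
    mul_inv_cancel_comm, mul_add, pow_add, mul_left_comm 2 s, mul_left_comm 2 t, mul_comm s,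
    mul_comm t, pow_mul _ _ s, pow_mul _ _ t]
  simp only [mul_pow]
  generalize squareChar exists_yN σ ^ s = A
  generalize squareChar exists_yN τ ^ s = B
  generalize squareChar exists_xN σ ^ t = C
  generalize squareChar exists_xN τ ^ t = D
  generalize (circleI ^ (2 * (b * d))) ^ s = E
  generalize (circleI ^ (2 * (a * c))) ^ t = F
  rw [inv_inv, ← mul_inv, eq_comm, inv_mul_eq_iff_eq_mul]
  simp only [mul_comm, mul_left_comm]

end IzumiKosaki

/-- `U` and `V` commute with everything in sight, so each relation reduces to one in G₁ with the
squares f₅ and f₆ inserted: f₁² and f₄² are multiplied by f₅. The third generator is f₃f₁f₄ rather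
than f₃, because (f₃f₁f₄)² = f₅f₆ and V² = f₆ leave the required f₅; both elements act on N in the
same way. -/
lemma PcModel.Relations.twist {P : Type*} [Group P] (F : PcModel 0 →* P) {U V : P}
    (hU : ∀ w, U * F w = F w * U) (hV : ∀ w, V * F w = F w * V) (hUV : V * U = U * V)
    (hU2 : U * U = F (PcModel.gens 4)) (hV2 : V * V = F (PcModel.gens 5)) :
    PcModel.Relations 1 ![F (PcModel.gens 0) * U, F (PcModel.gens 1),
      F (PcModel.gens 2 * PcModel.gens 0 * PcModel.gens 3) * V, F (PcModel.gens 3) * U,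
      F (PcModel.gens 4), F (PcModel.gens 5)] := by
  have aU := fun w => PcModel.mul_eq_assoc (hU w)
  have aV := fun w => PcModel.mul_eq_assoc (hV w)
  have hF (v w) : F v * F w = F (v * w) := (map_mul F v w).symm
  have aF := fun v w => PcModel.mul_eq_assoc (hF v w)
  have v1 : (1 : ZMod 2).val = 1 := rfl
  constructor <;>
    simp only [Matrix.cons_val, sub_self, ZMod.val_zero, v1, pow_zero, pow_one, mul_assoc, hU, hV,
      hUV, hU2, hV2, aU, aV, hF, aF, ← map_one F] <;>
    first
      | (refine congrArg F ?_; decide +kernel)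
      | (refine congrArg (fun w => F w * U) ?_; decide +kernel)
      | (refine congrArg (fun w => F w * V) ?_; decide +kernel)
      | (refine congrArg (fun w => F w * (U * V)) ?_; decide +kernel)

/-! ### Unitary square roots of involutions in the group algebra -/

section HalfTwist

variable {G : Type} [Group G]

/-- The element `(1 + z)/2 + i(1 - z)/2` for an involution `z`. -/
noncomputable def halfTwist (z : G) : MonoidAlgebra ℂ G :=
  MonoidAlgebra.single 1 ((1 + Complex.I) / 2) + MonoidAlgebra.single z ((1 - Complex.I) / 2)

lemma groupStar_halfTwist {z : G} (hz : z * z = 1) :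
    groupStar (halfTwist z) =
      MonoidAlgebra.single 1 ((1 - Complex.I) / 2) +
        MonoidAlgebra.single z ((1 + Complex.I) / 2) := by
  rw [halfTwist, groupStar_add, groupStar_single, groupStar_single, inv_one,
    inv_eq_of_mul_eq_one_left hz]
  simp [sub_eq_add_neg]

lemma single_add_single_mul {z : G} (hz : z * z = 1) (a b c d : ℂ) :
    (MonoidAlgebra.single 1 a + MonoidAlgebra.single z b) *
      (MonoidAlgebra.single 1 c + MonoidAlgebra.single z d) =
      MonoidAlgebra.single 1 (a * c + b * d) + MonoidAlgebra.single z (a * d + b * c) := by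
  simp only [add_mul, mul_add, MonoidAlgebra.single_mul_single, one_mul, mul_one, hz,
    MonoidAlgebra.single_add]
  abel

lemma halfTwist_mul_self {z : G} (hz : z * z = 1) :
    halfTwist z * halfTwist z = MonoidAlgebra.single z 1 := by
  rw [halfTwist, single_add_single_mul hz]
  have h1 : (1 + Complex.I) / 2 * ((1 + Complex.I) / 2) +
      (1 - Complex.I) / 2 * ((1 - Complex.I) / 2) = 0 := by
    linear_combination (1 / 2 : ℂ) * Complex.I_sq
  have h2 : (1 + Complex.I) / 2 * ((1 - Complex.I) / 2) +
      (1 - Complex.I) / 2 * ((1 + Complex.I) / 2) = 1 := by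
    linear_combination (-1 / 2 : ℂ) * Complex.I_sq
  rw [h1, h2, MonoidAlgebra.single_zero, zero_add]

lemma groupStar_halfTwist_mul {z : G} (hz : z * z = 1) :
    groupStar (halfTwist z) * halfTwist z = 1 := by
  rw [groupStar_halfTwist hz, halfTwist, single_add_single_mul hz]
  have h1 : (1 - Complex.I) / 2 * ((1 + Complex.I) / 2) +
      (1 + Complex.I) / 2 * ((1 - Complex.I) / 2) = 1 := by
    linear_combination (-1 / 2 : ℂ) * Complex.I_sq
  have h2 : (1 - Complex.I) / 2 * ((1 - Complex.I) / 2) +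
      (1 + Complex.I) / 2 * ((1 + Complex.I) / 2) = 0 := by
    linear_combination (1 / 2 : ℂ) * Complex.I_sq
  rw [h1, h2, MonoidAlgebra.single_zero, add_zero, MonoidAlgebra.one_def]

lemma halfTwist_mul_groupStar {z : G} (hz : z * z = 1) :
    halfTwist z * groupStar (halfTwist z) = 1 := by
  rw [← groupStar_halfTwist_mul hz, groupStar_halfTwist hz, halfTwist, single_add_single_mul hz,
    single_add_single_mul hz]
  congr 2 <;> ring

/-- The element `(1 + z)/2 + i(1 - z)/2` as a unit. -/
noncomputable def halfTwistUnit (z : G) (hz : z * z = 1) : (MonoidAlgebra ℂ G)ˣ where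
  val := halfTwist z
  inv := groupStar (halfTwist z)
  val_inv := halfTwist_mul_groupStar hz
  inv_val := groupStar_halfTwist_mul hz

lemma halfTwist_mul_single {z : G} (hz : ∀ g, z * g = g * z) (g : G) (c : ℂ) :
    halfTwist z * MonoidAlgebra.single g c = MonoidAlgebra.single g c * halfTwist z := by
  simp only [halfTwist, add_mul, mul_add, MonoidAlgebra.single_mul_single, one_mul, mul_one, hz,
    mul_comm c]

lemma counit_halfTwist (z : G) : Coalgebra.counit (R := ℂ) (halfTwist z) = (1 : ℂ) := by
  rw [halfTwist, map_add, MonoidAlgebra.counit_single, MonoidAlgebra.counit_single]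
  simp
  ring

/-- For an involution `n` the scalar is 1 or i according to the sign of `σ n`: the half twist is a
function on the dual group. -/
lemma halfTwist_mul_dualProj {N : Subgroup G} [Fintype N] (n : N) (σ : CharGroup N) :
    halfTwist (n : G) * dualProj N σ =
      ((1 + Complex.I) / 2 + (1 - Complex.I) / 2 * σ n) • dualProj N σ := by
  have h : halfTwist (n : G) = ((1 + Complex.I) / 2) • 1 +
      ((1 - Complex.I) / 2) • MonoidAlgebra.single (n : G) (1 : ℂ) := by
    simp [halfTwist, MonoidAlgebra.one_def]
  rw [h, add_mul, smul_mul_assoc, smul_mul_assoc, single_mul_dualProj, one_mul, smul_smul, add_smul]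

/-- In terms of functions on the dual group, the coproduct evaluates at the product of two
characters. -/
lemma comul_halfTwist_mul {N : Subgroup G} [Fintype N] (n : N) (σ τ : CharGroup N) :
    Coalgebra.comul (R := ℂ) (halfTwist (n : G)) * (dualProj N σ ⊗ₜ[ℂ] dualProj N τ) =
      ((1 + Complex.I) / 2 + (1 - Complex.I) / 2 * (σ * τ) n) •
        (dualProj N σ ⊗ₜ[ℂ] dualProj N τ) := by
  have h : halfTwist (n : G) = ((1 + Complex.I) / 2) • 1 +
      ((1 - Complex.I) / 2) • MonoidAlgebra.single (n : G) (1 : ℂ) := by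
    simp [halfTwist, MonoidAlgebra.one_def]
  have h1 : Coalgebra.comul (R := ℂ) (MonoidAlgebra.single (n : G) (1 : ℂ)) =
      MonoidAlgebra.single (n : G) (1 : ℂ) ⊗ₜ[ℂ] MonoidAlgebra.single (n : G) (1 : ℂ) := by
    simp
  rw [h, map_add, map_smul, map_smul, Bialgebra.comul_one, h1, add_mul, smul_mul_assoc,
    smul_mul_assoc, one_mul, Algebra.TensorProduct.tmul_mul_tmul, single_mul_dualProj,
    single_mul_dualProj, TensorProduct.smul_tmul_smul, smul_smul, add_smul]
  simp

end HalfTwist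

/-- Conjugation permutes the projections; the inverse comes from the convention σ^g(n) = σ(gng⁻¹).
-/
lemma single_mul_dualProj_conj {G : Type} [Group G] {N : Subgroup G} [N.Normal] [Fintype N] (g : G)
    (σ : CharGroup N) : MonoidAlgebra.single g (1 : ℂ) * dualProj N σ =
      dualProj N (conjDual N g⁻¹ σ) * MonoidAlgebra.single g 1 := by
  rw [dualProj_eq_sum, dualProj_eq_sum, Finset.mul_sum, Finset.sum_mul]
  refine (Equiv.sum_comp (MulAut.conjNormal g : MulAut N).toEquiv _).symm.trans ?_ |>.symm
  refine Finset.sum_congr rfl fun n _ => ?_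
  have h : conjDual N g⁻¹ σ (MulAut.conjNormal g n) = σ n := by
    change σ (MulAut.conjNormal g⁻¹ (MulAut.conjNormal g n)) = σ n
    rw [← MulAut.mul_apply, ← map_mul]
    simp
  simp only [MulEquiv.toEquiv_eq_coe, EquivLike.coe_coe, h, MonoidAlgebra.single_mul_single]
  simp [MulAut.conjNormal_apply]

/-! ### Unitary group-like elements for the twisted coproduct -/

section GroupLike

variable {G : Type} [Group G] (N : Subgroup G) (ω : CharGroup N → CharGroup N → Circle)

/-- The unitaries of the group algebra that are group-like for the twisted coproduct. -/
noncomputable def groupLikeUnits : Subgroup (MonoidAlgebra ℂ G)ˣ where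
  carrier := {v | groupStar (v : MonoidAlgebra ℂ G) * v = 1 ∧
    Coalgebra.comul (R := ℂ) (v : MonoidAlgebra ℂ G) * cocycleElement N ω =
      cocycleElement N ω * ((v : MonoidAlgebra ℂ G) ⊗ₜ[ℂ] (v : MonoidAlgebra ℂ G)) ∧
    Coalgebra.counit (R := ℂ) (v : MonoidAlgebra ℂ G) = (1 : ℂ)}
  one_mem' := by
    refine ⟨by simp [MonoidAlgebra.one_def, groupStar_single], ?_, ?_⟩
    · rw [Units.val_one, Bialgebra.comul_one, ← Algebra.TensorProduct.one_def, one_mul, mul_one]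
    · rw [Units.val_one, Bialgebra.counit_one]
  mul_mem' := by
    rintro v w ⟨hv1, hv2, hv3⟩ ⟨hw1, hw2, hw3⟩
    refine ⟨?_, ?_, ?_⟩
    · rw [Units.val_mul, UnitaryRep.groupStar_mul, mul_assoc,
        ← mul_assoc (groupStar (v : MonoidAlgebra ℂ G)), hv1, one_mul, hw1]
    · rw [Units.val_mul, Bialgebra.comul_mul, mul_assoc, hw2, ← mul_assoc, hv2, mul_assoc,
        Algebra.TensorProduct.tmul_mul_tmul]
    · rw [Units.val_mul, Bialgebra.counit_mul, hv3, hw3, one_mul]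
  inv_mem' := by
    rintro v ⟨hv1, hv2, hv3⟩
    have h1 : groupStar (1 : MonoidAlgebra ℂ G) = 1 := by
      simp [MonoidAlgebra.one_def, groupStar_single]
    refine ⟨?_, ?_, ?_⟩
    · have hs : groupStar (v : MonoidAlgebra ℂ G) = (v⁻¹ : (MonoidAlgebra ℂ G)ˣ) :=
        (Units.mul_eq_one_iff_eq_inv (u := v)).1 hv1
      have h := UnitaryRep.groupStar_mul (v : MonoidAlgebra ℂ G) (v⁻¹ : (MonoidAlgebra ℂ G)ˣ)
      rw [Units.mul_inv, h1, hs] at h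
      exact h.symm
    -- The identity for `v` is multiplied by Δ(v⁻¹) on the left and by v⁻¹ ⊗ v⁻¹ on the right.
    · have hl : Coalgebra.comul (R := ℂ) ((v⁻¹ : (MonoidAlgebra ℂ G)ˣ) : MonoidAlgebra ℂ G) *
          Coalgebra.comul (R := ℂ) (v : MonoidAlgebra ℂ G) = 1 := by
        rw [← Bialgebra.comul_mul, Units.inv_mul, Bialgebra.comul_one]
      have hr : ((v : MonoidAlgebra ℂ G) ⊗ₜ[ℂ] (v : MonoidAlgebra ℂ G)) *
          (((v⁻¹ : (MonoidAlgebra ℂ G)ˣ) : MonoidAlgebra ℂ G) ⊗ₜ[ℂ]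
            ((v⁻¹ : (MonoidAlgebra ℂ G)ˣ) : MonoidAlgebra ℂ G)) = 1 := by
        rw [Algebra.TensorProduct.tmul_mul_tmul, Units.mul_inv, Algebra.TensorProduct.one_def]
      calc _ = Coalgebra.comul (R := ℂ) ((v⁻¹ : (MonoidAlgebra ℂ G)ˣ) : MonoidAlgebra ℂ G) *
            (cocycleElement N ω * ((v : MonoidAlgebra ℂ G) ⊗ₜ[ℂ] (v : MonoidAlgebra ℂ G))) *
            (((v⁻¹ : (MonoidAlgebra ℂ G)ˣ) : MonoidAlgebra ℂ G) ⊗ₜ[ℂ]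
              ((v⁻¹ : (MonoidAlgebra ℂ G)ˣ) : MonoidAlgebra ℂ G)) := by
            rw [mul_assoc, mul_assoc, hr, mul_one]
        _ = _ := by
            rw [← hv2, ← mul_assoc, hl, one_mul]
    · have h := Bialgebra.counit_mul (R := ℂ) (v : MonoidAlgebra ℂ G)
        ((v⁻¹ : (MonoidAlgebra ℂ G)ˣ) : MonoidAlgebra ℂ G)
      rw [Units.mul_inv, hv3, one_mul, Bialgebra.counit_one] at h
      exact h.symm

/-- The group elements as units of the group algebra. -/
noncomputable def singleUnit (G : Type) [Group G] : G →* (MonoidAlgebra ℂ G)ˣ :=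
  (MonoidAlgebra.of ℂ G).toHomUnits

lemma coe_singleUnit (g : G) :
    (singleUnit G g : MonoidAlgebra ℂ G) = MonoidAlgebra.single g 1 := rfl

variable {N ω}

/-- Here `u` is the function ξ on the dual group. Moving `g` past the projections turns the
group-like equation for `g * u` into the scalar equation `hω`: the coboundary of ξ compensates the
change of ω under conjugation. -/
lemma singleUnit_mul_mem [N.Normal] [Fintype N] [IsMulCommutative N] {g : G}
    {u : (MonoidAlgebra ℂ G)ˣ} {ξ : CharGroup N → ℂ}
    (hs : groupStar (u : MonoidAlgebra ℂ G) * u = 1)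
    (hc : Coalgebra.counit (R := ℂ) (u : MonoidAlgebra ℂ G) = (1 : ℂ))
    (hu : ∀ σ : CharGroup N, (u : MonoidAlgebra ℂ G) * dualProj N σ = ξ σ • dualProj N σ)
    (hΔ : ∀ σ τ : CharGroup N, Coalgebra.comul (R := ℂ) (u : MonoidAlgebra ℂ G) *
      (dualProj N σ ⊗ₜ[ℂ] dualProj N τ) = ξ (σ * τ) • (dualProj N σ ⊗ₜ[ℂ] dualProj N τ))
    (hω : ∀ σ τ : CharGroup N, (ω σ τ : ℂ) * ξ (σ * τ) =
      ξ σ * ξ τ * ω (conjDual N g⁻¹ σ) (conjDual N g⁻¹ τ)) :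
    singleUnit G g * u ∈ groupLikeUnits N ω := by
  have := Fintype.ofFinite (CharGroup N)
  have hg : Coalgebra.comul (R := ℂ) (MonoidAlgebra.single g (1 : ℂ)) =
      MonoidAlgebra.single g (1 : ℂ) ⊗ₜ[ℂ] MonoidAlgebra.single g (1 : ℂ) := by
    simp
  refine ⟨?_, ?_, ?_⟩
  · rw [Units.val_mul, UnitaryRep.groupStar_mul, coe_singleUnit, groupStar_single, mul_assoc,
      ← mul_assoc (MonoidAlgebra.single _ _), MonoidAlgebra.single_mul_single]
    simp [← MonoidAlgebra.one_def, hs]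
  · refine eq_of_mul_tmul_eq (N := N) fun σ τ => ?_
    have hr (σ : CharGroup N) : ((singleUnit G g * u : (MonoidAlgebra ℂ G)ˣ) : MonoidAlgebra ℂ G) *
        dualProj N σ = ξ σ • (dualProj N (conjDual N g⁻¹ σ) * MonoidAlgebra.single g 1) := by
      rw [Units.val_mul, mul_assoc, hu, mul_smul_comm, coe_singleUnit, single_mul_dualProj_conj]
    have hR : cocycleElement N ω *
        (((singleUnit G g * u : (MonoidAlgebra ℂ G)ˣ) : MonoidAlgebra ℂ G) ⊗ₜ[ℂ]
          ((singleUnit G g * u : (MonoidAlgebra ℂ G)ˣ) : MonoidAlgebra ℂ G)) *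
        (dualProj N σ ⊗ₜ[ℂ] dualProj N τ) =
        (ξ σ * ξ τ * ω (conjDual N g⁻¹ σ) (conjDual N g⁻¹ τ)) •
        ((dualProj N (conjDual N g⁻¹ σ) * MonoidAlgebra.single g 1) ⊗ₜ[ℂ]
          (dualProj N (conjDual N g⁻¹ τ) * MonoidAlgebra.single g 1)) := by
      rw [mul_assoc, Algebra.TensorProduct.tmul_mul_tmul, hr, hr, TensorProduct.smul_tmul_smul,
        mul_smul_comm, ← Algebra.TensorProduct.tmul_mul_tmul, ← mul_assoc,
        cocycleElement_mul_tmul, smul_mul_assoc, smul_smul]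
    rw [hR, mul_assoc, cocycleElement_mul_tmul, mul_smul_comm, Units.val_mul, Bialgebra.comul_mul,
      mul_assoc, hΔ, mul_smul_comm, coe_singleUnit, hg, Algebra.TensorProduct.tmul_mul_tmul,
      single_mul_dualProj_conj, single_mul_dualProj_conj, smul_smul, hω]
  · rw [Units.val_mul, Bialgebra.counit_mul, hc, coe_singleUnit, MonoidAlgebra.counit_single]
    simp

end GroupLike

/-! ### Twisted group-like elements in the group algebra of G₁ -/

namespace IzumiKosaki

open PcModel (equivOne equivTwo equivOne_of)

/-- Modulo 4 a square is 0 or 1 according to parity, so i^(a²) depends only on the sign i^(2a) =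
(-1)^a. -/
lemma half_add_half_mul_I_pow (a : ℕ) :
    (1 + Complex.I) / 2 + (1 - Complex.I) / 2 * Complex.I ^ (a * 2) = Complex.I ^ (a * a) := by
  obtain ⟨k, rfl | rfl⟩ := Nat.even_or_odd' a
  · have e1 : 2 * k * 2 = 4 * k := by ring
    have e2 : 2 * k * (2 * k) = 4 * (k * k) := by ring
    rw [e1, e2, pow_mul, pow_mul, Complex.I_pow_four, one_pow, one_pow]
    ring
  · have e1 : (2 * k + 1) * 2 = 4 * k + 2 := by ring
    have e2 : (2 * k + 1) * (2 * k + 1) = 4 * (k * k + k) + 1 := by ring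
    rw [e1, e2, pow_add, pow_add, pow_mul, pow_mul, Complex.I_pow_four, one_pow, one_pow,
      Complex.I_sq]
    ring

lemma half_eq_squareChar {n : subgroupN}
    (hn : ∀ σ : CharGroup subgroupN, ∃ a : ℕ, σ n = circleI ^ a) (σ : CharGroup subgroupN) :
    (1 + Complex.I) / 2 + (1 - Complex.I) / 2 * (σ (n ^ 2) : ℂ) = squareChar hn σ := by
  obtain ⟨a, ha⟩ := hn σ
  rw [squareChar_eq hn ha, map_pow, ha, ← pow_mul, Circle.coe_pow, Circle.coe_pow, coe_circleI,
    half_add_half_mul_I_pow]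

lemma coe_xN_sq : ((xN ^ 2 : subgroupN) : GroupOne) = PresentedGroup.of 4 := by
  apply equivOne.injective
  rw [Subgroup.coe_pow, map_pow, equivOne_of]
  refine (congrArg (· ^ 2) (map_mul equivOne (PresentedGroup.of 0) (PresentedGroup.of 3))).trans ?_
  rw [equivOne_of, equivOne_of]
  decide +kernel

lemma coe_yN_sq : ((yN ^ 2 : subgroupN) : GroupOne) = PresentedGroup.of 5 :=
  (pow_two (PresentedGroup.of 1)).trans PcModel.relations_groupOne.sq_one

lemma xN_sq_mul_self : ((xN ^ 2 : subgroupN) : GroupOne) * (xN ^ 2 : subgroupN) = 1 := by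
  rw [coe_xN_sq, PcModel.relations_groupOne.sq_four]

lemma yN_sq_mul_self : ((yN ^ 2 : subgroupN) : GroupOne) * (yN ^ 2 : subgroupN) = 1 := by
  rw [coe_yN_sq, PcModel.relations_groupOne.sq_five]

/-- The unit `(1 + f₅)/2 + i(1 - f₅)/2`. -/
noncomputable def unitFive : (MonoidAlgebra ℂ GroupOne)ˣ := halfTwistUnit _ xN_sq_mul_self

/-- The unit `(1 + f₆)/2 + i(1 - f₆)/2`. -/
noncomputable def unitSix : (MonoidAlgebra ℂ GroupOne)ˣ := halfTwistUnit _ yN_sq_mul_self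

/-- The hypotheses say s = 0 and t = 1 for g⁻¹, so ω changes by i^(2ac), the polarization of the
function i^(a²) represented by `unitFive`. -/
lemma singleUnit_mul_unitFive_mem {g : GroupOne} (hc : (equivOne g⁻¹).c = 0)
    (had : (equivOne g⁻¹).a + (equivOne g⁻¹).d = 1) :
    singleUnit GroupOne g * unitFive ∈ groupLikeUnits subgroupN cocycle := by
  refine singleUnit_mul_mem (groupStar_halfTwist_mul xN_sq_mul_self) (counit_halfTwist _)
    (fun σ => halfTwist_mul_dualProj (xN ^ 2) σ) (fun σ τ => comul_halfTwist_mul (xN ^ 2) σ τ)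
    fun σ τ => ?_
  simp only [half_eq_squareChar exists_xN, ← Circle.coe_mul]
  refine congrArg _ ?_
  obtain ⟨s, t, hs, ht, h⟩ := cocycle_conjDual g⁻¹
  obtain ⟨a, ha⟩ := exists_xN σ
  obtain ⟨b, hb⟩ := exists_yN σ
  obtain ⟨c, hc'⟩ := exists_xN τ
  obtain ⟨d, hd⟩ := exists_yN τ
  rw [hc, ZMod.val_zero] at hs
  rw [had, ZMod.val_one'' (by norm_num)] at ht
  rw [h ha hb hc' hd, squareChar_mul exists_xN ha hc', hs, ht, zero_mul, zero_add, one_mul]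
  simp only [mul_left_comm]

lemma singleUnit_mul_unitSix_mem {g : GroupOne} (hc : (equivOne g⁻¹).c = 1)
    (had : (equivOne g⁻¹).a + (equivOne g⁻¹).d = 0) :
    singleUnit GroupOne g * unitSix ∈ groupLikeUnits subgroupN cocycle := by
  refine singleUnit_mul_mem (groupStar_halfTwist_mul yN_sq_mul_self) (counit_halfTwist _)
    (fun σ => halfTwist_mul_dualProj (yN ^ 2) σ) (fun σ τ => comul_halfTwist_mul (yN ^ 2) σ τ)
    fun σ τ => ?_
  simp only [half_eq_squareChar exists_yN, ← Circle.coe_mul]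
  refine congrArg _ ?_
  obtain ⟨s, t, hs, ht, h⟩ := cocycle_conjDual g⁻¹
  obtain ⟨a, ha⟩ := exists_xN σ
  obtain ⟨b, hb⟩ := exists_yN σ
  obtain ⟨c, hc'⟩ := exists_xN τ
  obtain ⟨d, hd⟩ := exists_yN τ
  rw [hc, ZMod.val_one'' (by norm_num)] at hs
  rw [had, ZMod.val_zero] at ht
  rw [h ha hb hc' hd, squareChar_mul exists_yN hb hd, hs, ht, zero_mul, add_zero, one_mul]
  simp only [mul_left_comm]

/-- Here conjugation fixes N pointwise, so no correction is needed. -/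
lemma singleUnit_mem {g : GroupOne} (hc : (equivOne g⁻¹).c = 0)
    (had : (equivOne g⁻¹).a + (equivOne g⁻¹).d = 0) :
    singleUnit GroupOne g ∈ groupLikeUnits subgroupN cocycle := by
  rw [← mul_one (singleUnit GroupOne g)]
  refine singleUnit_mul_mem (ξ := 1) ?_ ?_ (fun σ => ?_) (fun σ τ => ?_) fun σ τ => ?_
  · simp [MonoidAlgebra.one_def, groupStar_single]
  · rw [Units.val_one, Bialgebra.counit_one]
  · simp
  · simp
  · obtain ⟨s, t, hs, ht, h⟩ := cocycle_conjDual g⁻¹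
    obtain ⟨a, ha⟩ := exists_xN σ
    obtain ⟨b, hb⟩ := exists_yN σ
    obtain ⟨c, hc'⟩ := exists_xN τ
    obtain ⟨d, hd⟩ := exists_yN τ
    rw [hc, ZMod.val_zero] at hs
    rw [had, ZMod.val_zero] at ht
    rw [h ha hb hc' hd, hs, ht]
    simp

/-! ### `G₂` as the twist of `G₁` -/

/-- The units of `ℂ[G₁]` that satisfy the relations of `G₂`. -/
noncomputable def twistedGens : Fin 6 → (MonoidAlgebra ℂ GroupOne)ˣ :=
  ![singleUnit _ (PresentedGroup.of 0) * unitFive, singleUnit _ (PresentedGroup.of 1),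
    singleUnit _ (PresentedGroup.of 2 * PresentedGroup.of 0 * PresentedGroup.of 3) * unitSix,
    singleUnit _ (PresentedGroup.of 3) * unitFive, singleUnit _ (PresentedGroup.of 4),
    singleUnit _ (PresentedGroup.of 5)]

lemma commute_of_four (g : GroupOne) :
    (PresentedGroup.of 4 : GroupOne) * g = g * PresentedGroup.of 4 := by
  apply equivOne.injective
  rw [map_mul, map_mul, equivOne_of]
  generalize equivOne g = w
  revert w
  decide +kernel

lemma commute_of_five (g : GroupOne) :
    (PresentedGroup.of 5 : GroupOne) * g = g * PresentedGroup.of 5 := by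
  apply equivOne.injective
  rw [map_mul, map_mul, equivOne_of]
  generalize equivOne g = w
  revert w
  decide +kernel

lemma unitFive_mul_singleUnit (g : GroupOne) :
    unitFive * singleUnit GroupOne g = singleUnit GroupOne g * unitFive :=
  Units.ext (halfTwist_mul_single (by rw [coe_xN_sq]; exact commute_of_four) g 1)

lemma unitSix_mul_singleUnit (g : GroupOne) :
    unitSix * singleUnit GroupOne g = singleUnit GroupOne g * unitSix :=
  Units.ext (halfTwist_mul_single (by rw [coe_yN_sq]; exact commute_of_five) g 1)

lemma unitSix_mul_unitFive : unitSix * unitFive = unitFive * unitSix := by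
  refine Units.ext ?_
  have h := halfTwist_mul_single (z := ((yN ^ 2 : subgroupN) : GroupOne))
    (by rw [coe_yN_sq]; exact commute_of_five)
  change halfTwist _ * halfTwist _ = halfTwist _ * halfTwist _
  conv_lhs => rw [halfTwist.eq_def (((xN ^ 2 : subgroupN) : GroupOne))]
  conv_rhs => rw [halfTwist.eq_def (((xN ^ 2 : subgroupN) : GroupOne))]
  rw [mul_add, add_mul, h, h]

lemma unitFive_mul_self : unitFive * unitFive = singleUnit _ (PresentedGroup.of 4) :=
  Units.ext ((halfTwist_mul_self xN_sq_mul_self).trans (by rw [coe_xN_sq]; rfl))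

lemma unitSix_mul_self : unitSix * unitSix = singleUnit _ (PresentedGroup.of 5) :=
  Units.ext ((halfTwist_mul_self yN_sq_mul_self).trans (by rw [coe_yN_sq]; rfl))

lemma symm_gens (i : Fin 6) : equivOne.symm (PcModel.gens i) = PresentedGroup.of i := by
  rw [← equivOne_of, MulEquiv.symm_apply_apply]

lemma relations_twistedGens : PcModel.Relations 1 twistedGens := by
  have h := PcModel.Relations.twist
    ((singleUnit GroupOne).comp equivOne.symm.toMonoidHom) (U := unitFive) (V := unitSix)
    (fun w => unitFive_mul_singleUnit _) (fun w => unitSix_mul_singleUnit _) unitSix_mul_unitFive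
    (unitFive_mul_self.trans (congrArg _ (symm_gens 4).symm))
    (unitSix_mul_self.trans (congrArg _ (symm_gens 5).symm))
  simpa [symm_gens, twistedGens] using h

lemma twistedGens_mem (i : Fin 6) : twistedGens i ∈ groupLikeUnits subgroupN cocycle := by
  fin_cases i
  · refine singleUnit_mul_unitFive_mem ?_ ?_ <;> rw [map_inv, equivOne_of] <;> decide +kernel
  · refine singleUnit_mem ?_ ?_ <;> rw [map_inv, equivOne_of] <;> decide +kernel
  · refine singleUnit_mul_unitSix_mem ?_ ?_ <;>
      rw [map_inv, map_mul, map_mul, equivOne_of, equivOne_of, equivOne_of] <;> decide +kernel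
  · refine singleUnit_mul_unitFive_mem ?_ ?_ <;> rw [map_inv, equivOne_of] <;> decide +kernel
  · refine singleUnit_mem ?_ ?_ <;> rw [map_inv, equivOne_of] <;> decide +kernel
  · refine singleUnit_mem ?_ ?_ <;> rw [map_inv, equivOne_of] <;> decide +kernel

/-- The group-like units as a group homomorphism from `G₂`. -/
noncomputable def twistedHom : GroupTwo →* (MonoidAlgebra ℂ GroupOne)ˣ :=
  TableGroup.lift twistedGens relations_twistedGens.table₂

lemma twistedHom_of (i : Fin 6) : twistedHom (PresentedGroup.of i) = twistedGens i :=
  TableGroup.lift_of _ _ i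

lemma twistedHom_mem (k : GroupTwo) : twistedHom k ∈ groupLikeUnits subgroupN cocycle := by
  have h : Subgroup.closure (Set.range (PresentedGroup.of : Fin 6 → GroupTwo)) ≤
      (groupLikeUnits subgroupN cocycle).comap twistedHom := by
    rw [Subgroup.closure_le]
    rintro _ ⟨i, rfl⟩
    change twistedHom _ ∈ groupLikeUnits subgroupN cocycle
    rw [twistedHom_of]
    exact twistedGens_mem i
  rw [PresentedGroup.closure_range_of] at h
  exact h (Subgroup.mem_top k)

/-- The algebra homomorphism `ℂ[G₂] → ℂ[G₁]`. -/
noncomputable def twistedAlgHom : MonoidAlgebra ℂ GroupTwo →ₐ[ℂ] MonoidAlgebra ℂ GroupOne :=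
  MonoidAlgebra.lift ℂ (MonoidAlgebra ℂ GroupOne) GroupTwo ((Units.coeHom _).comp twistedHom)

lemma twistedAlgHom_single (k : GroupTwo) (c : ℂ) :
    twistedAlgHom (MonoidAlgebra.single k c) =
      c • (twistedHom k : MonoidAlgebra ℂ GroupOne) :=
  MonoidAlgebra.lift_single _ _ _

lemma coe_twistedGens_mem_range (i : Fin 6) :
    (twistedGens i : MonoidAlgebra ℂ GroupOne) ∈ twistedAlgHom.range :=
  ⟨MonoidAlgebra.single (PresentedGroup.of i) 1, by
    change twistedAlgHom _ = _
    rw [twistedAlgHom_single, one_smul, twistedHom_of]⟩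

lemma halfTwist_mem {G : Type} [Group G] {S : Subalgebra ℂ (MonoidAlgebra ℂ G)} {z : G}
    (hz : z * z = 1) (h : MonoidAlgebra.single z 1 ∈ S) :
    halfTwist z ∈ S ∧ groupStar (halfTwist z) ∈ S := by
  have h1 (c : ℂ) : MonoidAlgebra.single 1 c ∈ S := by
    have := S.algebraMap_mem c
    simpa using this
  have h2 (c : ℂ) : MonoidAlgebra.single z c ∈ S := by
    have := S.smul_mem h c
    simpa using this
  rw [groupStar_halfTwist hz]
  exact ⟨add_mem (h1 _) (h2 _), add_mem (h1 _) (h2 _)⟩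

/-- The range contains f₅ and f₆, hence the adjoints of `unitFive` and `unitSix`; multiplying by
these removes the corrections from the twisted generators. -/
lemma single_mem_range (i : Fin 6) :
    MonoidAlgebra.single (PresentedGroup.of i : GroupOne) (1 : ℂ) ∈ twistedAlgHom.range := by
  have h4 : MonoidAlgebra.single (PresentedGroup.of 4 : GroupOne) (1 : ℂ) ∈ twistedAlgHom.range :=
    coe_twistedGens_mem_range 4
  have h5 : MonoidAlgebra.single (PresentedGroup.of 5 : GroupOne) (1 : ℂ) ∈ twistedAlgHom.range :=
    coe_twistedGens_mem_range 5
  have hU := (halfTwist_mem xN_sq_mul_self (by rwa [coe_xN_sq])).2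
  have hV := (halfTwist_mem yN_sq_mul_self (by rwa [coe_yN_sq])).2
  have hU' {v : (MonoidAlgebra ℂ GroupOne)ˣ}
      (h : ((v * unitFive : (MonoidAlgebra ℂ GroupOne)ˣ) : MonoidAlgebra ℂ GroupOne) ∈
        twistedAlgHom.range) : (v : MonoidAlgebra ℂ GroupOne) ∈ twistedAlgHom.range := by
    have := mul_mem h hU
    rwa [Units.val_mul, mul_assoc, show (unitFive : MonoidAlgebra ℂ GroupOne) * _ = 1 from
      halfTwist_mul_groupStar xN_sq_mul_self, mul_one] at this
  have hV' {v : (MonoidAlgebra ℂ GroupOne)ˣ}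
      (h : ((v * unitSix : (MonoidAlgebra ℂ GroupOne)ˣ) : MonoidAlgebra ℂ GroupOne) ∈
        twistedAlgHom.range) : (v : MonoidAlgebra ℂ GroupOne) ∈ twistedAlgHom.range := by
    have := mul_mem h hV
    rwa [Units.val_mul, mul_assoc, show (unitSix : MonoidAlgebra ℂ GroupOne) * _ = 1 from
      halfTwist_mul_groupStar yN_sq_mul_self, mul_one] at this
  have h0 : MonoidAlgebra.single (PresentedGroup.of 0 : GroupOne) (1 : ℂ) ∈ twistedAlgHom.range :=
    hU' (coe_twistedGens_mem_range 0)
  have h3 : MonoidAlgebra.single (PresentedGroup.of 3 : GroupOne) (1 : ℂ) ∈ twistedAlgHom.range :=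
    hU' (coe_twistedGens_mem_range 3)
  have h2 : MonoidAlgebra.single (PresentedGroup.of 2 * PresentedGroup.of 0 *
      PresentedGroup.of 3 : GroupOne) (1 : ℂ) ∈ twistedAlgHom.range :=
    hV' (coe_twistedGens_mem_range 2)
  -- The factor f₄f₁f₅ is the inverse of f₁f₄, because (f₁f₄)² = f₅.
  have e2 : (PresentedGroup.of 2 : GroupOne) = PresentedGroup.of 2 * PresentedGroup.of 0 *
      PresentedGroup.of 3 * (PresentedGroup.of 3 * PresentedGroup.of 0 * PresentedGroup.of 4) := by
    apply equivOne.injective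
    simp only [map_mul, equivOne_of]
    decide +kernel
  fin_cases i
  · exact h0
  · exact coe_twistedGens_mem_range 1
  · have h := mul_mem h2 (mul_mem (mul_mem h3 h0) h4)
    simp only [MonoidAlgebra.single_mul_single, one_mul] at h
    rw [← e2] at h
    exact h
  · exact h3
  · exact h4
  · exact h5

lemma twistedAlgHom_surjective : Function.Surjective twistedAlgHom := by
  have h (g : GroupOne) : MonoidAlgebra.single g (1 : ℂ) ∈ twistedAlgHom.range := by
    let S : Submonoid GroupOne :=
      twistedAlgHom.range.toSubmonoid.comap (MonoidAlgebra.of ℂ GroupOne)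
    have hg : g ∈ Subgroup.closure (Set.range (PresentedGroup.of : Fin 6 → GroupOne)) := by
      rw [PresentedGroup.closure_range_of]
      exact Subgroup.mem_top g
    have : g ∈ S := by
      induction hg using Subgroup.closure_induction with
      | mem x hx =>
        obtain ⟨i, rfl⟩ := hx
        exact single_mem_range i
      | one => exact S.one_mem
      | mul x y _ _ hx hy => exact S.mul_mem hx hy
      | inv x _ hx =>
        -- The exponent divides 4, so inverses are cubes and a submonoid suffices.
        have h4 : x * x ^ 3 = 1 := equivOne.injective <| by
          rw [← pow_succ', map_pow, PcModel.pow_four_eq_one, map_one]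
        rw [inv_eq_of_mul_eq_one_right h4]
        exact S.pow_mem hx 3
    exact this
  intro a
  change a ∈ twistedAlgHom.range
  induction a using MonoidAlgebra.induction_linear with
  | zero => exact zero_mem _
  | add a b ha hb => exact add_mem ha hb
  | single g c =>
    have := Subalgebra.smul_mem _ (h g) c
    simpa using this

lemma card_groupOne : Nat.card GroupOne = 64 :=
  (Nat.card_congr equivOne.toEquiv).trans PcModel.card_eq

lemma card_groupTwo : Nat.card GroupTwo = 64 :=
  (Nat.card_congr equivTwo.toEquiv).trans PcModel.card_eq

lemma finrank_groupAlgebra (G : Type) [Group G] [Finite G] :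
    Module.finrank ℂ (MonoidAlgebra ℂ G) = Nat.card G := by
  have := Fintype.ofFinite G
  rw [(MonoidAlgebra.coeffLinearEquiv ℂ).finrank_eq, Module.finrank_finsupp_self,
    Nat.card_eq_fintype_card]

lemma twistedAlgHom_bijective : Function.Bijective twistedAlgHom := by
  have h1 : Finite GroupOne := Finite.of_equiv _ equivOne.symm.toEquiv
  have h2 : Finite GroupTwo := Finite.of_equiv _ equivTwo.symm.toEquiv
  have h3 : FiniteDimensional ℂ (MonoidAlgebra ℂ GroupOne) :=
    Module.Finite.equiv (MonoidAlgebra.coeffLinearEquiv ℂ).symm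
  have h4 : FiniteDimensional ℂ (MonoidAlgebra ℂ GroupTwo) :=
    Module.Finite.equiv (MonoidAlgebra.coeffLinearEquiv ℂ).symm
  refine ⟨?_, twistedAlgHom_surjective⟩
  refine (LinearMap.injective_iff_surjective_of_finrank_eq_finrank (f := twistedAlgHom.toLinearMap)
    ?_).2 twistedAlgHom_surjective
  rw [finrank_groupAlgebra, finrank_groupAlgebra, card_groupOne, card_groupTwo]

/-- The isomorphism of group algebras that exhibits `G₂` as a twist of `G₁`. -/
noncomputable def twistedAlgEquiv : MonoidAlgebra ℂ GroupTwo ≃ₐ[ℂ] MonoidAlgebra ℂ GroupOne :=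
  AlgEquiv.ofBijective twistedAlgHom twistedAlgHom_bijective

lemma twistedAlgEquiv_single (k : GroupTwo) (c : ℂ) :
    twistedAlgEquiv (MonoidAlgebra.single k c) =
      c • (twistedHom k : MonoidAlgebra ℂ GroupOne) :=
  twistedAlgHom_single k c

lemma twistedAlgHom_groupStar (a : MonoidAlgebra ℂ GroupTwo) :
    twistedAlgHom (groupStar a) = groupStar (twistedAlgHom a) := by
  induction a using MonoidAlgebra.induction_linear with
  | zero => simp [groupStar]
  | add a b ha hb => rw [groupStar_add, map_add, map_add, groupStar_add, ha, hb]
  | single k c =>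
    have h : groupStar (twistedHom k : MonoidAlgebra ℂ GroupOne) =
        ((twistedHom k)⁻¹ : (MonoidAlgebra ℂ GroupOne)ˣ) :=
      (Units.mul_eq_one_iff_eq_inv (u := twistedHom k)).1 (twistedHom_mem k).1
    rw [groupStar_single, twistedAlgHom_single, twistedAlgHom_single, UnitaryRep.groupStar_smul, h,
      map_inv]

lemma twistedComul_add {G : Type} [Group G] (N : Subgroup G)
    (ω : CharGroup N → CharGroup N → Circle) (a b : MonoidAlgebra ℂ G) :
    twistedComul N ω (a + b) = twistedComul N ω a + twistedComul N ω b := by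
  simp only [twistedComul, map_add, mul_add, add_mul]

lemma twistedComul_smul {G : Type} [Group G] (N : Subgroup G)
    (ω : CharGroup N → CharGroup N → Circle) (c : ℂ) (a : MonoidAlgebra ℂ G) :
    twistedComul N ω (c • a) = c • twistedComul N ω a := by
  simp only [twistedComul, map_smul, mul_smul_comm, smul_mul_assoc]

lemma twistedComul_twistedAlgEquiv (a : MonoidAlgebra ℂ GroupTwo) :
    twistedComul subgroupN cocycle (twistedAlgEquiv a) =
      TensorProduct.map twistedAlgEquiv.toLinearMap twistedAlgEquiv.toLinearMap
        (Coalgebra.comul (R := ℂ) a) := by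
  induction a using MonoidAlgebra.induction_linear with
  | zero => simp [twistedComul]
  | add a b ha hb => rw [map_add, twistedComul_add, ha, hb, map_add, map_add]
  | single k c =>
    have hk : (MonoidAlgebra.single k c : MonoidAlgebra ℂ GroupTwo) =
        c • MonoidAlgebra.single k 1 := by simp
    have h1 : Coalgebra.comul (R := ℂ) (MonoidAlgebra.single k (1 : ℂ)) =
        MonoidAlgebra.single k (1 : ℂ) ⊗ₜ[ℂ] MonoidAlgebra.single k (1 : ℂ) := by
      simp
    have h2 := twistedAlgEquiv_single k 1
    rw [one_smul] at h2
    -- The group-like equation moves ω past the coproduct, where it cancels against its inverse.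
    rw [hk, map_smul, map_smul, map_smul, twistedComul_smul, h1, TensorProduct.map_tmul,
      AlgEquiv.toLinearMap_apply, h2, twistedComul, mul_assoc, (twistedHom_mem k).2.1, ← mul_assoc,
      cocycleElement_inv_mul, one_mul]

lemma isTwistIso_twistedAlgEquiv : IsTwistIso subgroupN cocycle twistedAlgEquiv where
  star := twistedAlgHom_groupStar
  comul := twistedComul_twistedAlgEquiv
  counit k := by
    rw [twistedAlgEquiv_single, one_smul]
    exact (twistedHom_mem k).2.2
  cocycle := isTwoCocycle_cocycle
  one_left := cocycle_one_left
  one_right := cocycle_one_right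

end IzumiKosaki

theorem mainTheorem3 :
    Nat.card GroupOne = 64 ∧ Nat.card GroupTwo = 64 ∧
    orderList GroupOne = [1, 19, 44, 0, 0, 0, 0] ∧
    orderList GroupTwo = [1, 19, 44, 0, 0, 0, 0] ∧
    IsEmpty (GroupOne ≃* GroupTwo) ∧
    MonoidallyEquivalent GroupOne GroupTwo ∧
    ∃ (e : GroupOne ≃* IzumiKosakiGroup) (_ : subgroupN.Normal)
      (ω : CharGroup subgroupN → CharGroup subgroupN → Circle),
      e (genOne 1 * genOne 4) = columnVec 1 0 ∧
      e (genOne 2) = columnVec 0 1 ∧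
      subgroupN.map e.toMonoidHom = (SemidirectProduct.inl (φ := actionH)).range ∧
      (∀ (σ τ : CharGroup subgroupN) (a b : ℕ), (σ xN : ℂ) = Complex.I ^ a →
        (τ yN : ℂ) = Complex.I ^ b → (ω σ τ : ℂ) = Complex.I ^ (a * b)) ∧
      IsTwoCocycle ω ∧ IsNondegenerate ω ∧ IsInvariantCocycle subgroupN ω ∧
      IsTwistBy subgroupN ω GroupTwo :=
  ⟨IzumiKosaki.card_groupOne, IzumiKosaki.card_groupTwo, PcModel.orderList_eq PcModel.equivOne,
    PcModel.orderList_eq PcModel.equivTwo, PcModel.isEmpty_groupOne_mulEquiv_groupTwo,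
    IzumiKosaki.isTwistIso_twistedAlgEquiv.monoidallyEquivalent, IzumiKosaki.equiv, inferInstance,
    IzumiKosaki.cocycle, IzumiKosaki.hom_genOne_mul, IzumiKosaki.hom_genOne_two,
    IzumiKosaki.map_hom_subgroupN, fun _ _ _ _ => IzumiKosaki.cocycle_of_coe,
    IzumiKosaki.isTwoCocycle_cocycle, IzumiKosaki.isNondegenerate_cocycle,
    IzumiKosaki.isInvariantCocycle_cocycle, IzumiKosaki.twistedAlgEquiv,
    IzumiKosaki.isTwistIso_twistedAlgEquiv.star, IzumiKosaki.isTwistIso_twistedAlgEquiv.comul⟩
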